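/- Let $K$ be an algebraically closed field and let $V=\bigoplus_{i\in\mathbb Z}V_i$ be a finite-dimensional graded $K$-vector space. Algebras are associative and not necessarily unital. Let $\mathrm{gAss}_V(K)$ be the affine variety of graded associative algebra structures on $V$, that is, of the linear maps $\varphi:V\otimes_K V\to V$ such that $\varphi\circ(\varphi\otimes\mathrm{id})=\varphi\circ(\mathrm{id}\otimes\varphi)$ and $\varphi(V_i\otimes V_j)\subseteq V_{i+j}$ for all $i,j\in\mathbb Z$. The group $\mathrm{gGL}(V)$ of linear automorphisms of $V$ of degree $0$ acts on it by $g\cdot\varphi=g\circ\varphi\circ(g^{-1}\otimes g^{-1})$. For $A\in\mathrm{gAss}_V(K)$ let $\mathcal O_A$ be the orbit of $A$ and $\overline{\mathcal O_A}$ its Zariski closure in $\mathrm{gAss}_V(K)$. For $A,B\in\mathrm{gAss}_V(K)$, the algebra $B$ is a graded degeneration of $A$ if $\mathcal O_B\subseteq\overline{\mathcal O_A}$. Regard $K$ as a $K[[t]]$-algebra through evaluation at $t=0$. A graded (Gerstenhaber) formal deformation of a graded $K$-algebra $B$ is a $\mathbb Z$-graded $K[[t]]$-algebra $\tilde X$ that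 is complete and separated for the $t$-adic topology and torsion-free over $K[[t]]$, together with an isomorphism $\tilde X\otimes_{K[[t]]}K\cong B$ of graded $K$-algebras (multiplicative and homogeneous of degree $0$). Theorem. Let $A,B\in\mathrm{gAss}_V(K)$. Then $B$ is a graded degeneration of $A$ if and only if there exists a graded formal deformation $\tilde X$ of $B$ such that $\tilde X\otimes_{K[[t]]}K((t))$ and $A\otimes_K K((t))$ are isomorphic as graded $K((t))$-algebras. -/

import Mathlib

open scoped TensorProduct PowerSeries LaurentSeries

universe u v w

namespace GradedDegeneration



/-! ### Graded algebras

Algebras are associative and not necessarily unital. A grading of an `R`-module `M` is a family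
`ℳ : ℤ → Submodule R M` with `DirectSum.IsInternal ℳ`, that is `M = ⨁ i, ℳ i`. -/

/-- An isomorphism of graded `R`-algebras: an `R`-linear equivalence that is multiplicative and
maps the component of degree `i` onto the component of degree `i`, for every `i`. -/
structure GradedAlgEquiv (R : Type*) [CommRing R] {X Y : Type*}
    [NonUnitalRing X] [Module R X] [NonUnitalRing Y] [Module R Y]
    (𝒳 : ℤ → Submodule R X) (𝒴 : ℤ → Submodule R Y) extends X ≃ₗ[R] Y where
  map_mul' : ∀ x y : X, toLinearEquiv (x * y) = toLinearEquiv x * toLinearEquiv y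
  map_grading' : ∀ i : ℤ, (𝒳 i).map (toLinearEquiv : X →ₗ[R] Y) = 𝒴 i

section Variety

variable {K : Type u} [Field K] {V : Type v} [AddCommGroup V] [Module K V]

/-- The set of graded associative algebra structures on the graded vector space `(V, 𝒱)`: the
linear maps `φ : V ⊗ V → V` with `φ ∘ (φ ⊗ id) = φ ∘ (id ⊗ φ)` and
`φ (𝒱 i ⊗ 𝒱 j) ⊆ 𝒱 (i + j)`. -/
def GradedAss (𝒱 : ℤ → Submodule K V) : Set (V ⊗[K] V →ₗ[K] V) :=
  {φ | φ ∘ₗ TensorProduct.map φ LinearMap.id =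
        φ ∘ₗ TensorProduct.map LinearMap.id φ ∘ₗ (TensorProduct.assoc K V V V).toLinearMap ∧
      ∀ i j : ℤ, ∀ x ∈ 𝒱 i, ∀ y ∈ 𝒱 j, φ (x ⊗ₜ[K] y) ∈ 𝒱 (i + j)}

/-- The group of linear automorphisms of `V` of degree `0`. -/
def GradedGL (𝒱 : ℤ → Submodule K V) : Subgroup (V ≃ₗ[K] V) where
  carrier := {g | ∀ i : ℤ, ∀ x : V, g x ∈ 𝒱 i ↔ x ∈ 𝒱 i}
  one_mem' := fun _ _ => Iff.rfl
  mul_mem' := fun {g h} hg hh i x => (hg i (h x)).trans (hh i x)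
  inv_mem' := fun {g} hg i x => by
    have h := hg i (g⁻¹ x)
    rw [show g (g⁻¹ x) = x from g.apply_symm_apply x] at h
    exact h.symm

/-- Transport of structure: `g ∘ φ ∘ (g⁻¹ ⊗ g⁻¹)`. -/
def transport (g : V ≃ₗ[K] V) (φ : V ⊗[K] V →ₗ[K] V) : V ⊗[K] V →ₗ[K] V :=
  (g : V →ₗ[K] V) ∘ₗ φ ∘ₗ
    TensorProduct.map ((g⁻¹ : V ≃ₗ[K] V) : V →ₗ[K] V) ((g⁻¹ : V ≃ₗ[K] V) : V →ₗ[K] V)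

@[simp]
theorem transport_tmul (g : V ≃ₗ[K] V) (φ : V ⊗[K] V →ₗ[K] V) (x y : V) :
    transport g φ (x ⊗ₜ[K] y) = g (φ ((g⁻¹ x) ⊗ₜ[K] (g⁻¹ y))) := rfl

theorem assoc_apply {𝒱 : ℤ → Submodule K V} (φ : GradedAss 𝒱) (x y z : V) :
    φ.1 (φ.1 (x ⊗ₜ[K] y) ⊗ₜ[K] z) = φ.1 (x ⊗ₜ[K] φ.1 (y ⊗ₜ[K] z)) := by
  simpa using LinearMap.congr_fun φ.2.1 ((x ⊗ₜ[K] y) ⊗ₜ[K] z)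

theorem transport_mem {𝒱 : ℤ → Submodule K V} (g : GradedGL 𝒱) (φ : GradedAss 𝒱) :
    transport g.1 φ.1 ∈ GradedAss 𝒱 := by
  have hinv : ∀ x : V, g.1⁻¹ (g.1 x) = x := fun x => g.1.symm_apply_apply x
  refine ⟨?_, ?_⟩
  · refine TensorProduct.ext_threefold fun x y z => ?_
    simp [hinv, assoc_apply]
  · intro i j x hx y hy
    exact (g.2 _ _).2 (φ.2.2 i j _ (((g⁻¹).2 i x).2 hx) _ (((g⁻¹).2 j y).2 hy))

/-- The action of the group of automorphisms of degree `0` by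
`g • φ = g ∘ φ ∘ (g⁻¹ ⊗ g⁻¹)`. -/
instance (𝒱 : ℤ → Submodule K V) : MulAction (GradedGL 𝒱) (GradedAss 𝒱) where
  smul g φ := ⟨transport g.1 φ.1, transport_mem g φ⟩
  one_smul φ := Subtype.ext (TensorProduct.ext' fun _ _ => rfl)
  mul_smul g h φ := Subtype.ext (TensorProduct.ext' fun x y => by
    change transport (g.1 * h.1) φ.1 (x ⊗ₜ[K] y) = transport g.1 (transport h.1 φ.1) (x ⊗ₜ[K] y)
    simp [mul_inv_rev])

/-- The Zariski closure of `S` in the variety of graded algebra structures: the points at which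
every polynomial function vanishing on `S` vanishes. A polynomial function on
`W = Hom (V ⊗ V, V)` is a polynomial expression in finitely many linear forms on `W`. -/
def zariskiClosure {𝒱 : ℤ → Submodule K V} (S : Set (GradedAss 𝒱)) : Set (GradedAss 𝒱) :=
  {ψ | ∀ p : MvPolynomial (Module.Dual K (V ⊗[K] V →ₗ[K] V)) K,
    (∀ φ ∈ S, MvPolynomial.eval (fun ξ => ξ φ.1) p = 0) →
      MvPolynomial.eval (fun ξ => ξ ψ.1) p = 0}

/-- `B` is a graded degeneration of `A`: the orbit of `B` is contained in the Zariski closure of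
the orbit of `A`. -/
def IsGradedDegeneration {𝒱 : ℤ → Submodule K V} (B A : GradedAss 𝒱) : Prop :=
  MulAction.orbit (GradedGL 𝒱) B ⊆ zariskiClosure (MulAction.orbit (GradedGL 𝒱) A)

/-- The algebra with underlying vector space `V` given by a point of the variety. -/
def GradedAss.Alg {𝒱 : ℤ → Submodule K V} (_A : GradedAss 𝒱) : Type v := V

section Alg

variable {𝒱 : ℤ → Submodule K V} (A : GradedAss 𝒱)

instance : AddCommGroup (GradedAss.Alg A) := inferInstanceAs (AddCommGroup V)

instance : Module K (GradedAss.Alg A) := inferInstanceAs (Module K V)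

instance : NonUnitalRing (GradedAss.Alg A) where
  __ := (inferInstance : AddCommGroup (GradedAss.Alg A))
  mul x y := A.1 ((x : V) ⊗ₜ[K] (y : V))
  left_distrib x y z := (congrArg A.1 (TensorProduct.tmul_add (R := K) (x : V) y z)).trans
    (map_add A.1 _ _)
  right_distrib x y z := (congrArg A.1 (TensorProduct.add_tmul (R := K) (x : V) y z)).trans
    (map_add A.1 _ _)
  zero_mul x := (congrArg A.1 (TensorProduct.zero_tmul (R := K) V (x : V))).trans (map_zero A.1)
  mul_zero x := (congrArg A.1 (TensorProduct.tmul_zero (R := K) V (x : V))).trans (map_zero A.1)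
  mul_assoc x y z := assoc_apply A x y z

theorem GradedAss.Alg.mul_def (x y : GradedAss.Alg A) :
    x * y = (A.1 ((show V from x) ⊗ₜ[K] (show V from y)) : V) := rfl

instance : IsScalarTower K (GradedAss.Alg A) (GradedAss.Alg A) where
  smul_assoc c x y := (congrArg A.1 (TensorProduct.smul_tmul' c (show V from x)
    (show V from y)).symm).trans (map_smul A.1 c _)

instance : SMulCommClass K (GradedAss.Alg A) (GradedAss.Alg A) where
  smul_comm c x y := ((congrArg A.1 (TensorProduct.tmul_smul c (show V from x)
    (show V from y))).trans (map_smul A.1 c _)).symm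

/-- The grading of the algebra `A`, namely that of `V`. -/
def GradedAss.grading : ℤ → Submodule K (GradedAss.Alg A) := 𝒱

end Alg

end Variety

section Deformation

/-- `K` as an algebra over `K⟦X⟧` through evaluation at `0`. -/
@[reducible]
noncomputable def residueAlgebra (K : Type u) [Field K] : Algebra K⟦X⟧ K :=
  (PowerSeries.constantCoeff (R := K)).toAlgebra

attribute [local instance] residueAlgebra

/-- A graded (Gerstenhaber) formal deformation of a graded `K`-algebra `(B, ℬ)`: a graded
`K⟦X⟧`-algebra, complete (and separated) for the `X`-adic topology and torsion-free, together with
an isomorphism of graded `K`-algebras between its specialization at `0` and `B`. -/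
structure GradedFormalDeformation (K : Type u) [Field K] (B : Type v) [NonUnitalRing B]
    [Module K B] (ℬ : ℤ → Submodule K B) where
  carrier : Type w
  [ring : NonUnitalRing carrier]
  [module : Module K⟦X⟧ carrier]
  [isScalarTower : IsScalarTower K⟦X⟧ carrier carrier]
  [smulCommClass : SMulCommClass K⟦X⟧ carrier carrier]
  grading : ℤ → Submodule K⟦X⟧ carrier
  isInternal : DirectSum.IsInternal grading
  gradedMul : SetLike.GradedMul grading
  complete : IsAdicComplete (Ideal.span {(PowerSeries.X : K⟦X⟧)}) carrier
  torsionFree : Module.IsTorsionFree K⟦X⟧ carrier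
  specialization :
    GradedAlgEquiv K (X := K ⊗[K⟦X⟧] carrier) (fun i => (grading i).baseChange K) ℬ

attribute [instance] GradedFormalDeformation.ring GradedFormalDeformation.module
  GradedFormalDeformation.isScalarTower GradedFormalDeformation.smulCommClass

end Deformation

end GradedDegeneration

/-! Among the two (propositionally equal) `K`-algebra structures on `K⸨X⸩` that Mathlib provides,
use the one given by constant series, whose scalar multiplication is coefficientwise. -/

attribute [local instance 2000] HahnSeries.instAlgebra

/-!
Fix a homogeneous basis of `V`. A point of the variety is then a family of structure constants, and
`GradedGL 𝒱` is the group of invertible homogeneous matrices; it is an open subset of an affine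
space, so its coordinate ring `GenericRing` is a finitely generated domain. A polynomial vanishes on
the orbit of `A` if and only if it vanishes at the structure constants `genericConst` obtained by
transporting `A` along the generic matrix (`forall_mem_orbit_iff`), because `K` is infinite.

A complete torsion-free `K⟦X⟧`-module with finite-dimensional reduction is free, on any lift of a
basis of the reduction (`exists_basis_of_complete`). Hence a graded formal deformation of `B` is the
same as a family of homogeneous associative structure constants over `K⟦X⟧` that specialize to
those of `B`, and an isomorphism with `A` over `K⸨X⸩` is an invertible homogeneous matrix over
`K⸨X⸩` that transports `A` to this family. Such a matrix is a `K⸨X⸩`-point of `GenericRing`, so a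
polynomial vanishing on the orbit of `A` vanishes on the family and therefore at `B`
(`mem_closure_of_formalDeformation`).

Conversely, if `B` lies in the closure of the orbit, such a point has to be constructed
(`exists_laurent_point`). Take a valuation ring of the fraction field of `GenericRing` that
dominates the local ring of the closure at `B`. Replacing each generator of `GenericRing` outside
the valuation ring by its inverse gives a finitely generated domain `T` with a rational point `β`
above `B`, and `GenericRing` embeds into a localization `T[1/f]`. It remains to find a formal curve
through `β` on which `f` does not vanish identically (`exists_powerSeries_point`). Dividing by a
prime that is maximal among those below `β` not containing `f` leaves a local domain of dimension
at most one, by Krull's principal ideal theorem. A valuation ring dominating it is discrete with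
residue field `K`, by the counting argument of Krull and Akizuki (`finite_quotient_of_birational`),
and expansion in powers of a uniformizer maps it to `K⟦X⟧` (`exists_expansion`).
-/

namespace GradedDegeneration

/-! ### Expansion in powers of a uniformizer -/

section Expansion

variable {K O : Type*} [Field K] [CommRing O] [IsDomain O] [Algebra K O]

/-- The pairs `(a, f)` such that the power series `f` is the expansion of `a` in powers of `π`:
modulo every power of `π` the element `a` is the value at `π` of a polynomial that agrees with `f`
modulo the same power of `X`. -/
def expansionSubalgebra (K : Type*) {O : Type*} [Field K] [CommRing O] [Algebra K O] (π : O) :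
    Subalgebra K (O × K⟦X⟧) where
  carrier := {z | ∀ n : ℕ, ∃ p : Polynomial K,
    π ^ n ∣ z.1 - Polynomial.aeval π p ∧ PowerSeries.X ^ n ∣ z.2 - (p : K⟦X⟧)}
  mul_mem' := by
    rintro ⟨a, f⟩ ⟨b, g⟩ ha hb n
    obtain ⟨p, hp1, hp2⟩ := ha n
    obtain ⟨q, hq1, hq2⟩ := hb n
    refine ⟨p * q, ?_, ?_⟩
    · have : a * b - Polynomial.aeval π (p * q) = (a - Polynomial.aeval π p) * b
        + Polynomial.aeval π p * (b - Polynomial.aeval π q) := by rw [map_mul]; ring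
      exact this ▸ dvd_add (hp1.mul_right _) (hq1.mul_left _)
    · have : f * g - ((p * q : Polynomial K) : K⟦X⟧) = (f - (p : K⟦X⟧)) * g
        + (p : K⟦X⟧) * (g - (q : K⟦X⟧)) := by rw [Polynomial.coe_mul]; ring
      exact this ▸ dvd_add (hp2.mul_right _) (hq2.mul_left _)
  add_mem' := by
    rintro ⟨a, f⟩ ⟨b, g⟩ ha hb n
    obtain ⟨p, hp1, hp2⟩ := ha n
    obtain ⟨q, hq1, hq2⟩ := hb n
    refine ⟨p + q, ?_, ?_⟩
    · have : a + b - Polynomial.aeval π (p + q) = (a - Polynomial.aeval π p)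
        + (b - Polynomial.aeval π q) := by rw [map_add]; ring
      exact this ▸ dvd_add hp1 hq1
    · have : f + g - ((p + q : Polynomial K) : K⟦X⟧) = (f - (p : K⟦X⟧))
        + (g - (q : K⟦X⟧)) := by rw [Polynomial.coe_add]; ring
      exact this ▸ dvd_add hp2 hq2
  algebraMap_mem' c n := by
    refine ⟨Polynomial.C c, ?_, ?_⟩
    · simp
    · simp

/-- A polynomial is determined modulo `X ^ n` by its value at `π` modulo `π ^ n`, which makes the
expansion of an element unique. -/
theorem X_pow_dvd_of_pow_dvd_aeval {π : O} (hπ : π ≠ 0)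
    (hinj : Function.Injective (algebraMap K (O ⧸ Ideal.span {π}))) (n : ℕ) (p : Polynomial K)
    (h : π ^ n ∣ Polynomial.aeval π p) : Polynomial.X ^ n ∣ p := by
  induction n generalizing p with
  | zero => simp
  | succ n ih =>
    have hp := p.divX_mul_X_add
    have h0 : p.coeff 0 = 0 := by
      apply hinj
      rw [map_zero, IsScalarTower.algebraMap_apply K O, Ideal.Quotient.algebraMap_eq,
        Ideal.Quotient.eq_zero_iff_mem, Ideal.mem_span_singleton]
      have h1 : π ∣ Polynomial.aeval π p := (dvd_pow_self π n.succ_ne_zero).trans h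
      rw [← hp, map_add, map_mul, Polynomial.aeval_X, Polynomial.aeval_C] at h1
      exact (dvd_add_right (dvd_mul_left _ _)).1 h1
    rw [h0, map_zero, add_zero] at hp
    rw [← hp] at h ⊢
    rw [map_mul, Polynomial.aeval_X, pow_succ] at h
    rw [pow_succ]
    exact mul_dvd_mul_right (ih _ ((mul_dvd_mul_iff_right hπ).1 h)) _

/-- A domain over `K` with a nonzero element `π` such that `O / π = K` maps to `K⟦X⟧` by expansion
in powers of `π`. -/
theorem exists_expansion {π : O} (hπ : π ≠ 0)
    (hres : Function.Bijective (algebraMap K (O ⧸ Ideal.span {π}))) :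
    ∃ φ : O →ₐ[K] K⟦X⟧, φ π = PowerSeries.X := by
  classical
  let H := expansionSubalgebra K π
  let p1 : H →ₐ[K] O := (AlgHom.fst K O K⟦X⟧).comp H.val
  let p2 : H →ₐ[K] K⟦X⟧ := (AlgHom.snd K O K⟦X⟧).comp H.val
  have hinj : Function.Injective p1 := by
    rw [injective_iff_map_eq_zero]
    rintro ⟨⟨a, f⟩, hz⟩ (rfl : a = 0)
    have : f = 0 := by
      ext n
      obtain ⟨p, hp1, hp2⟩ := hz (n + 1)
      have h1 := X_pow_dvd_of_pow_dvd_aeval hπ hres.1 (n + 1) p (by simpa using hp1)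
      have h2 : (PowerSeries.X ^ (n + 1) : K⟦X⟧) ∣ (p : K⟦X⟧) := by
        obtain ⟨q, rfl⟩ := h1
        exact ⟨(q : K⟦X⟧), by simp⟩
      have h3 : (PowerSeries.X ^ (n + 1) : K⟦X⟧) ∣ f := by
        have := dvd_add hp2 h2
        simpa using this
      simpa using PowerSeries.X_pow_dvd_iff.1 h3 n (Nat.lt_succ_self n)
    subst this
    rfl
  have hstep : ∀ a : O, ∃ c : K, ∃ b : O, a = algebraMap K O c + π * b := by
    intro a
    obtain ⟨c, hc⟩ := hres.2 (Ideal.Quotient.mk _ a)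
    rw [IsScalarTower.algebraMap_apply K O, Ideal.Quotient.algebraMap_eq, eq_comm,
      Ideal.Quotient.eq, Ideal.mem_span_singleton] at hc
    obtain ⟨b, hb⟩ := hc
    exact ⟨c, b, by rw [← hb]; ring⟩
  choose c q hcq using hstep
  have hsurj : Function.Surjective p1 := by
    intro a
    let f : K⟦X⟧ := PowerSeries.mk fun n => c (q^[n] a)
    have hf : ∀ n, a - Polynomial.aeval π (PowerSeries.trunc n f) = π ^ n * q^[n] a := by
      intro n
      induction n with
      | zero => simp [PowerSeries.trunc_zero']
      | succ n ih =>
        rw [PowerSeries.trunc_succ, map_add, Polynomial.aeval_monomial, PowerSeries.coeff_mk,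
          Function.iterate_succ_apply', ← sub_sub, ih]
        have := hcq (q^[n] a)
        linear_combination (π ^ n) * this
    refine ⟨⟨(a, f), fun n => ⟨PowerSeries.trunc n f, ?_, ?_⟩⟩, rfl⟩
    · exact Dvd.intro _ (hf n).symm
    · rw [PowerSeries.X_pow_dvd_iff]
      intro m hm
      simp [PowerSeries.coeff_trunc, hm]
  let e : H ≃ₐ[K] O := AlgEquiv.ofBijective p1 ⟨hinj, hsurj⟩
  refine ⟨p2.comp e.symm.toAlgHom, ?_⟩
  have hmem : (π, (PowerSeries.X : K⟦X⟧)) ∈ H := fun n => ⟨Polynomial.X, by simp, by simp⟩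
  have : e.symm π = ⟨_, hmem⟩ := by
    rw [AlgEquiv.symm_apply_eq]; rfl
  change p2 (e.symm π) = _
  rw [this]; rfl

end Expansion

/-! ### Finite quotients of birational extensions -/

section FiniteQuotient

variable {K D : Type*} [Field K] [CommRing D] [Algebra K D]

/-- If `D` is a finite-dimensional subspace plus the ideal `I`, and `I` is finitely generated, then
the same holds for every power of `I`. -/
theorem exists_finite_complement_pow {I : Ideal D} (hI : I.FG)
    {W : Submodule K D} [FiniteDimensional K W] (hW : ∀ a, ∃ w ∈ W, a - w ∈ I) (n : ℕ) :
    ∃ W' : Submodule K D, FiniteDimensional K W' ∧ ∀ a, ∃ w ∈ W', a - w ∈ I ^ n := by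
  classical
  obtain ⟨s, rfl⟩ := hI
  induction n with
  | zero => exact ⟨⊥, inferInstance, fun a => ⟨0, by simp, by simp⟩⟩
  | succ n ih =>
    obtain ⟨W', hW', h⟩ := ih
    choose y hy hy' using h
    refine ⟨W ⊔ ⨆ g : s, W'.map (LinearMap.mulLeft K (g : D)), inferInstance, fun a => ?_⟩
    obtain ⟨w, hw, haw⟩ := hW a
    obtain ⟨c, -, hc⟩ := Submodule.mem_span_finset.1 haw
    refine ⟨w + ∑ g ∈ s, g * y (c g), add_mem (Submodule.mem_sup_left hw)
      (Submodule.mem_sup_right (sum_mem fun g hg => ?_)), ?_⟩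
    · exact Submodule.mem_iSup_of_mem (⟨g, hg⟩ : s)
        (Submodule.mem_map.2 ⟨y (c g), hy _, rfl⟩)
    · rw [← sub_sub, ← hc, ← Finset.sum_sub_distrib]
      refine sum_mem fun g hg => ?_
      have : c g • g - g * y (c g) = (c g - y (c g)) * g := by rw [smul_eq_mul]; ring
      rw [this, pow_succ]
      exact Ideal.mul_mem_mul (hy' _) (Ideal.subset_span hg)

/-- The dimension of `D / f ^ n` is at most `n` times that of `D / f`. -/
theorem exists_complement_span_pow {f : D} {W : Submodule K D} [FiniteDimensional K W]
    (hW : ∀ a, ∃ w ∈ W, f ∣ a - w) (n : ℕ) :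
    ∃ W' : Submodule K D, FiniteDimensional K W' ∧ Module.finrank K W' ≤ n * Module.finrank K W ∧
      ∀ a, ∃ w ∈ W', f ^ n ∣ a - w := by
  induction n with
  | zero => exact ⟨⊥, inferInstance, by simp, fun a => ⟨0, by simp, by simp⟩⟩
  | succ n ih =>
    obtain ⟨W', hW', hrank, h⟩ := ih
    refine ⟨W ⊔ W'.map (LinearMap.mulLeft K f), inferInstance, ?_, fun a => ?_⟩
    · refine (Submodule.finrank_add_le_finrank_add_finrank _ _).trans ?_
      have := Submodule.finrank_map_le (LinearMap.mulLeft K f) W'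
      rw [add_mul, one_mul]
      omega
    · obtain ⟨w, hw, c, hc⟩ := hW a
      obtain ⟨y, hy, b, hb⟩ := h c
      refine ⟨w + f * y, add_mem (Submodule.mem_sup_left hw)
        (Submodule.mem_sup_right (Submodule.mem_map.2 ⟨y, hy, rfl⟩)), b, ?_⟩
      linear_combination hc + f * hb

/-- A linear combination of the products `f ^ j * x i`, `j < n`, is divisible by `f ^ n` only if it
is trivial, provided that the `x i` are linearly independent modulo `f`. -/
theorem eq_zero_of_pow_dvd_sum [IsDomain D] {ι : Type*} [Fintype ι] {f : D} (hf : f ≠ 0) {x : ι → D}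
    (hx : ∀ c : ι → K, f ∣ ∑ i, c i • x i → c = 0) (n : ℕ) (c : Fin n → ι → K)
    (h : f ^ n ∣ ∑ j : Fin n, f ^ (j : ℕ) * ∑ i, c j i • x i) : c = 0 := by
  induction n with
  | zero => exact Subsingleton.elim _ _
  | succ n ih =>
    have hs : ∑ j : Fin (n + 1), f ^ (j : ℕ) * ∑ i, c j i • x i = ∑ i, c 0 i • x i
        + f * ∑ j : Fin n, f ^ (j : ℕ) * ∑ i, c j.succ i • x i := by
      rw [Fin.sum_univ_succ, Finset.mul_sum (s := (Finset.univ : Finset (Fin n)))]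
      simp [pow_succ', mul_assoc]
    rw [hs] at h
    have h0 : c 0 = 0 :=
      hx _ ((dvd_add_left (dvd_mul_right _ _)).1 ((dvd_pow_self f n.succ_ne_zero).trans h))
    have h1 : (fun j : Fin n => c j.succ) = 0 := by
      apply ih
      simp only [h0, Pi.zero_apply, zero_smul, Finset.sum_const_zero, zero_add] at h
      rw [pow_succ'] at h
      exact (mul_dvd_mul_iff_left hf).1 h
    funext j
    refine Fin.cases h0 (fun j => congrFun h1 j) j

/-- The counting argument of Krull and Akizuki: let `D ⊆ O` be domains with the same fraction field
and let `f ∈ D` be such that `D / f` is finite-dimensional and every nonzero element of `D` divides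
a power of `f`. Then `O / f` is finite-dimensional. -/
theorem finite_quotient_of_birational [IsDomain D] {O : Type*} [CommRing O] [IsDomain O]
    [Algebra K O]
    (j : D →ₐ[K] O) (hj : Function.Injective j)
    (hfrac : ∀ x : O, ∃ d : D, d ≠ 0 ∧ ∃ y, j d * x = j y)
    {f : D} (hf : f ≠ 0) (hfin : Module.Finite K (D ⧸ Ideal.span {f}))
    (hpow : ∀ d : D, d ≠ 0 → ∃ k, d ∣ f ^ k) :
    Module.Finite K (O ⧸ Ideal.span {j f}) := by
  classical
  obtain ⟨W, hWfin, hW⟩ : ∃ W : Submodule K D, FiniteDimensional K W ∧ ∀ a, ∃ w ∈ W, f ∣ a - w := by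
    let b := Module.finBasis K (D ⧸ Ideal.span {f})
    choose e he using fun i => Ideal.Quotient.mk_surjective (b i)
    refine ⟨Submodule.span K (Set.range e), FiniteDimensional.span_of_finite K (Set.finite_range e),
      fun a => ⟨∑ i, b.repr (Ideal.Quotient.mk _ a) i • e i,
        sum_mem fun i _ => Submodule.smul_mem _ _ (Submodule.subset_span ⟨i, rfl⟩), ?_⟩⟩
    rw [← Ideal.mem_span_singleton, ← Ideal.Quotient.eq_zero_iff_mem, map_sub, map_sum, sub_eq_zero]
    conv_lhs => rw [← b.sum_repr (Ideal.Quotient.mk _ a)]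
    refine Finset.sum_congr rfl fun i _ => ?_
    rw [← he i]
    rfl
  set ℓ := Module.finrank K W
  refine Module.rank_lt_aleph0_iff.1 (lt_of_le_of_lt (rank_le (n := ℓ) fun s hs => ?_)
    (Cardinal.natCast_lt_aleph0))
  choose x hx using fun i : s => Ideal.Quotient.mk_surjective (i : O ⧸ Ideal.span {j f})
  have hxind : ∀ c : s → K, j f ∣ ∑ i, c i • x i → c = 0 := by
    intro c hc
    rw [← Ideal.mem_span_singleton, ← Ideal.Quotient.eq_zero_iff_mem, map_sum] at hc
    refine funext (Fintype.linearIndependent_iff.1 hs c ?_)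
    rw [← hc]
    refine Finset.sum_congr rfl fun i _ => ?_
    rw [← hx i]
    rfl
  choose d hd y hy using fun i : s => hfrac (x i)
  set d' := ∏ i, d i with hd'
  have hd'0 : d' ≠ 0 := Finset.prod_ne_zero_iff.2 fun i _ => hd i
  have hy' : ∀ i, ∃ y', j d' * x i = j y' := fun i => by
    obtain ⟨e, he⟩ : d i ∣ d' := Finset.dvd_prod_of_mem d (Finset.mem_univ i)
    refine ⟨e * y i, ?_⟩
    rw [he, map_mul, map_mul, ← hy i]
    ring
  choose y' hy' using hy'
  obtain ⟨k, e, he⟩ := hpow d' hd'0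
  have hjd : j d' ≠ 0 := fun h => hd'0 (hj (by rw [h, map_zero]))
  have hjf : j f ≠ 0 := fun h => hf (hj (by rw [h, map_zero]))
  -- Counting the independent elements `f ^ j * y' i`, `j < n`, in `D / f ^ (n + k)`.
  have hcount : ∀ n : ℕ, n * s.card ≤ (n + k) * ℓ := by
    intro n
    obtain ⟨W', hW'fin, hrank, hW'⟩ := exists_complement_span_pow hW (n + k)
    refine le_trans ?_ hrank
    choose p hp hp' using fun z : Fin n × s => hW' (f ^ (z.1 : ℕ) * y' z.2)
    have hli : LinearIndependent K (fun z => (⟨p z, hp z⟩ : W')) := by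
      rw [Fintype.linearIndependent_iff]
      intro c hc
      have hc : ∑ z, c z • p z = 0 := by simpa using congrArg Subtype.val hc
      have h1 : f ^ (n + k) ∣ ∑ z, c z • (f ^ (z.1 : ℕ) * y' z.2) := by
        have : ∑ z, c z • (f ^ (z.1 : ℕ) * y' z.2)
            = ∑ z, c z • (f ^ (z.1 : ℕ) * y' z.2 - p z) := by
          simp_rw [smul_sub, Finset.sum_sub_distrib, hc, sub_zero]
        rw [this]
        refine Finset.dvd_sum fun z _ => ?_
        rw [Algebra.smul_def]
        exact (hp' z).mul_left _
      obtain ⟨q, hq⟩ := h1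
      have h2 : j d' * ∑ a : Fin n, j f ^ (a : ℕ) * ∑ i, c (a, i) • x i
          = j d' * (j f ^ n * (j e * j q)) := by
        have := congrArg j hq
        rw [pow_add, he, map_mul, map_mul, map_mul, map_pow] at this
        calc _ = j (∑ z, c z • (f ^ (z.1 : ℕ) * y' z.2)) := by
              rw [map_sum, Fintype.sum_prod_type, Finset.mul_sum]
              refine Finset.sum_congr rfl fun a _ => ?_
              rw [Finset.mul_sum, Finset.mul_sum]
              refine Finset.sum_congr rfl fun i _ => ?_
              rw [map_smul, map_mul, map_pow, ← hy' i, Algebra.smul_def, Algebra.smul_def]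
              ring
          _ = _ := by rw [this]; ring
      have h3 := eq_zero_of_pow_dvd_sum hjf hxind n (fun a i => c (a, i))
        ⟨_, mul_left_cancel₀ hjd h2⟩
      exact fun z => congrFun (congrFun h3 z.1) z.2
    simpa using hli.fintype_card_le_finrank
  by_contra! hlt
  have := hcount (k * ℓ + 1)
  have h5 : (k * ℓ + 1) * (ℓ + 1) ≤ (k * ℓ + 1) * s.card := Nat.mul_le_mul_left _ hlt
  nlinarith

end FiniteQuotient

/-! ### Formal curves -/

section Curves

open IsLocalRing

/-- A consequence of Krull's principal ideal theorem: if some nonzero element lies in all nonzero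
primes of a Noetherian local domain, then the domain has dimension at most one. -/
theorem eq_maximalIdeal_of_forall_mem {D : Type*} [CommRing D] [IsDomain D] [IsNoetherianRing D]
    [IsLocalRing D] {f : D} (hf : f ≠ 0) (H : ∀ P : Ideal D, P.IsPrime → P ≠ ⊥ → f ∈ P)
    (Q : Ideal D) [hQ : Q.IsPrime] (hfQ : f ∈ Q) : Q = maximalIdeal D := by
  by_contra hne
  have hfin := Ideal.finite_minimalPrimes_of_isNoetherianRing D (Ideal.span {f})
  have hQm : Q ≤ maximalIdeal D := le_maximalIdeal hQ.ne_top
  -- The maximal ideal is not minimal over `f`, so prime avoidance applies.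
  have hnot : ¬ ((maximalIdeal D : Set D) ⊆
      ⋃ P ∈ (↑hfin.toFinset : Set (Ideal D)), ((id P : Ideal D) : Set D)) := by
    rw [Ideal.subset_union_prime (⊥ : Ideal D) ⊥]
    · rintro ⟨P, hP, hmP⟩
      rw [Set.Finite.mem_toFinset] at hP
      have h1 : P ≤ Q := (hP.2 ⟨hQ, (Ideal.span_singleton_le_iff_mem _).2 hfQ⟩
        (hQm.trans hmP))
      exact hne (le_antisymm hQm (hmP.trans h1))
    · intro P hP _ _
      exact ((Set.Finite.mem_toFinset _).1 hP).1.1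
  obtain ⟨a, ham, ha⟩ := Set.not_subset.1 hnot
  have ha' : ∀ P ∈ (Ideal.span {f}).minimalPrimes, a ∉ P := by
    intro P hP haP
    exact ha (Set.mem_biUnion (by simpa using hP) haP)
  -- A prime minimal over `a` has height one, contains `f` and is not minimal over `f`.
  obtain ⟨P, hP, -⟩ := Ideal.exists_minimalPrimes_le
    ((Ideal.span_singleton_le_iff_mem (I := maximalIdeal D)).2 ham)
  have hPp : P.IsPrime := hP.1.1
  have haP : a ∈ P := (Ideal.span_singleton_le_iff_mem _).1 hP.1.2
  obtain ⟨P₁, hP₁, -⟩ := Ideal.exists_minimalPrimes_le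
    ((Ideal.span_singleton_le_iff_mem (I := Q)).2 hfQ)
  have hP0 : P ≠ ⊥ := by
    rintro rfl
    exact ha' P₁ hP₁ (by rw [(Submodule.mem_bot D).1 haP]; exact zero_mem _)
  obtain ⟨P₂, hP₂, hle⟩ := Ideal.exists_minimalPrimes_le
    ((Ideal.span_singleton_le_iff_mem (I := P)).2 (H P hPp hP0))
  have hP₂p : P₂.IsPrime := hP₂.1.1
  have hlt : P₂ < P := lt_of_le_of_ne hle (by rintro rfl; exact ha' _ hP₂ haP)
  have h1 := Ideal.height_add_one_le_of_lt_of_isPrime hlt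
  have h2 := Ideal.height_le_one_of_isPrincipal_of_mem_minimalPrimes _ P hP
  have h3 : P₂.height = 0 := by
    have := h1.trans h2
    have h4 : P₂.height + 1 ≤ 0 + 1 := by simpa using this
    exact le_antisymm (by simpa using (ENat.add_le_add_iff_right ENat.one_ne_top).1 h4) (zero_le)
  rw [Ideal.height_eq_zero_iff_eq_bot] at h3
  exact hf ((Submodule.mem_bot D).1 (h3 ▸ (Ideal.span_singleton_le_iff_mem _).1 hP₂.1.2))

variable {K : Type*} [Field K] [IsAlgClosed K]

/-- A one-dimensional Noetherian local domain over an algebraically closed field `K`, with residue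
field `K`, has a local homomorphism to `K⟦X⟧` that does not vanish at `f`. -/
theorem exists_powerSeries_point_of_isLocalRing {D : Type*} [CommRing D] [IsDomain D]
    [IsNoetherianRing D] [IsLocalRing D] [Algebra K D]
    (hres : ∀ a : D, ∃ c : K, a - algebraMap K D c ∈ maximalIdeal D)
    {f : D} (hf : f ≠ 0) (hfm : f ∈ maximalIdeal D)
    (H : ∀ P : Ideal D, P.IsPrime → P ≠ ⊥ → f ∈ P) :
    ∃ φ : D →ₐ[K] K⟦X⟧, φ f ≠ 0 ∧
      ∀ a ∈ maximalIdeal D, PowerSeries.constantCoeff (φ a) = 0 := by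
  have hfin : Module.Finite K (D ⧸ Ideal.span {f}) := by
    obtain ⟨k, hk⟩ := Ideal.exists_pow_le_of_le_radical_of_fg
      (I := maximalIdeal D) (J := Ideal.span {f}) (by
        rw [Ideal.radical_eq_sInf]
        refine le_sInf fun J hJ => ?_
        have := hJ.2
        exact (eq_maximalIdeal_of_forall_mem hf H J
          ((Ideal.span_singleton_le_iff_mem _).1 hJ.1)).ge) (IsNoetherian.noetherian _)
    obtain ⟨W, hW, h⟩ := exists_finite_complement_pow (K := K)
      (IsNoetherian.noetherian (maximalIdeal D)) (W := Submodule.span K {1})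
      (fun a => by
        obtain ⟨c, hc⟩ := hres a
        exact ⟨algebraMap K D c, Submodule.mem_span_singleton.2
          ⟨c, (Algebra.algebraMap_eq_smul_one c).symm⟩, hc⟩) k
    refine Module.Finite.of_surjective
      ((Ideal.Quotient.mkₐ K (Ideal.span {f})).toLinearMap ∘ₗ W.subtype) fun z => ?_
    obtain ⟨a, rfl⟩ := Ideal.Quotient.mk_surjective z
    obtain ⟨w, hw, haw⟩ := h a
    exact ⟨⟨w, hw⟩, ((Ideal.Quotient.eq).2 (hk haw)).symm⟩
  -- All primes containing a nonzero `d` contain `f`.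
  have hpow : ∀ d : D, d ≠ 0 → ∃ k, d ∣ f ^ k := by
    intro d hd
    have : f ∈ (Ideal.span {d}).radical := by
      rw [Ideal.radical_eq_sInf, Submodule.mem_sInf]
      intro J hJ
      refine H J hJ.2 ?_
      rintro rfl
      exact hd ((Submodule.mem_bot D).1 ((Ideal.span_singleton_le_iff_mem _).1 hJ.1))
    obtain ⟨k, hk⟩ := this
    exact ⟨k, Ideal.mem_span_singleton.1 hk⟩
  obtain ⟨A, hA, hloc⟩ := exists_factor_valuationRing (algebraMap D (FractionRing D))
  let g : D →+* A := (algebraMap D (FractionRing D)).codRestrict A.toSubring hA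
  have hgloc : IsLocalHom g := hloc
  let : Algebra K A := (g.comp (algebraMap K D)).toAlgebra
  let j : D →ₐ[K] A := { g with commutes' := fun _ => rfl }
  have hjval : ∀ d, (j d : FractionRing D) = algebraMap D (FractionRing D) d := fun _ => rfl
  have hj : Function.Injective j := fun x y h =>
    IsFractionRing.injective D (FractionRing D) (by rw [← hjval, h, hjval])
  have hjf : j f ≠ 0 := fun h => hf (hj (by rw [h, map_zero]))
  have hcomap : maximalIdeal D ≤ (maximalIdeal A).comap g := ((local_hom_TFAE g).out 0 3).1 hgloc
  have hjm : ∀ a ∈ maximalIdeal D, j a ∈ maximalIdeal A := fun a ha => hcomap ha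
  have hfinA : Module.Finite K (A ⧸ Ideal.span {j f}) := by
    refine finite_quotient_of_birational j hj (fun x => ?_) hf hfin hpow
    obtain ⟨⟨y, d⟩, hyd⟩ := IsLocalization.surj (nonZeroDivisors D) (x : FractionRing D)
    exact ⟨d, nonZeroDivisors.coe_ne_zero d, y, Subtype.ext (by
      rw [mul_comm]; exact hyd)⟩
  have hnoeth : IsNoetherian A (A ⧸ Ideal.span {j f}) := isNoetherian_of_tower K inferInstance
  -- The maximal ideal is finitely generated modulo `f`, hence finitely generated, hence principal.
  have hfg : (maximalIdeal A).FG := by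
    refine Submodule.fg_of_fg_map_of_fg_inf_ker (Ideal.span {j f}).mkQ
      (IsNoetherian.noetherian _) ?_
    rw [Submodule.ker_mkQ, inf_eq_right.2 ((Ideal.span_singleton_le_iff_mem _).2 (hjm f hfm))]
    exact Submodule.fg_span_singleton _
  obtain ⟨π, hπ⟩ := (IsBezout.isPrincipal_of_FG _ hfg).principal
  replace hπ : maximalIdeal A = Ideal.span {π} := hπ
  have hjfπ : j f ∈ Ideal.span {π} := hπ ▸ hjm f hfm
  have hπ0 : π ≠ 0 := by
    rintro rfl
    exact hjf (by simpa using hjfπ)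
  have hmax : (Ideal.span {π}).IsMaximal := hπ ▸ maximalIdeal.isMaximal A
  have hle : Ideal.span {j f} ≤ Ideal.span {π} := (Ideal.span_singleton_le_iff_mem _).2 hjfπ
  have hfinA' : Module.Finite K (A ⧸ Ideal.span {π}) :=
    Module.Finite.of_surjective
      (Ideal.Quotient.factorₐ K hle).toLinearMap (Ideal.Quotient.factor_surjective hle)
  have hint : Algebra.IsIntegral K (A ⧸ Ideal.span {π}) := Algebra.IsIntegral.of_finite K _
  obtain ⟨φ, hφ⟩ := exists_expansion hπ0 (K := K) IsAlgClosed.algebraMap_bijective_of_isIntegral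
  refine ⟨φ.comp j, ?_, fun a ha => ?_⟩
  -- Some power of `π` is a multiple of `f`, so `f` is not mapped to `0`.
  · have hart : IsArtinianRing (A ⧸ Ideal.span {j f}) := isArtinian_of_tower K inferInstance
    have hnil : IsNilpotent (Ideal.Quotient.mk (Ideal.span {j f}) π) := by
      rw [nilpotent_iff_mem_prime]
      intro J hJ
      have hJm : J.IsMaximal := inferInstance
      have := Ideal.comap_isMaximal_of_surjective (Ideal.Quotient.mk (Ideal.span {j f}))
        Ideal.Quotient.mk_surjective (K := J)
      rw [← Ideal.mem_comap, eq_maximalIdeal this, hπ]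
      exact Ideal.mem_span_singleton_self π
    obtain ⟨k, hk⟩ := hnil
    rw [← map_pow, Ideal.Quotient.eq_zero_iff_mem, Ideal.mem_span_singleton] at hk
    obtain ⟨b, hb⟩ := hk
    intro h
    have := congrArg φ hb
    rw [map_mul, map_pow, hφ] at this
    rw [show φ (j f) = 0 from h, zero_mul] at this
    exact pow_ne_zero k PowerSeries.X_ne_zero this
  · obtain ⟨b, hb⟩ := Ideal.mem_span_singleton.1 (hπ ▸ hjm a ha)
    change PowerSeries.constantCoeff (φ (j a)) = 0
    rw [hb, map_mul, hφ, map_mul, PowerSeries.constantCoeff_X, zero_mul]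

/-- Through a point `β` of an irreducible affine variety over an algebraically closed field passes
a formal curve that is not contained in the hypersurface `f = 0`. -/
theorem exists_powerSeries_point {T : Type*} [CommRing T] [IsDomain T] [Algebra K T]
    [Algebra.FiniteType K T] (β : T →ₐ[K] K) {f : T} (hf : f ≠ 0) :
    ∃ φ : T →ₐ[K] K⟦X⟧, φ f ≠ 0 ∧ ∀ a, PowerSeries.constantCoeff (φ a) = β a := by
  by_cases hβf : β f = 0
  swap
  · refine ⟨(Algebra.ofId K K⟦X⟧).comp β, ?_, fun a => ?_⟩
    · simpa [Algebra.ofId_apply] using hβf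
    · simp [Algebra.ofId_apply]
  have hnoeth : IsNoetherianRing T := Algebra.FiniteType.isNoetherianRing K T
  -- A prime maximal among those below the given point that do not contain `f`.
  obtain ⟨P, ⟨hP, hPβ, hfP⟩, hPmax⟩ := (inferInstance : WellFoundedGT (Ideal T)).wf.has_min
    {P : Ideal T | P.IsPrime ∧ P ≤ RingHom.ker β ∧ f ∉ P}
    ⟨⊥, Ideal.isPrime_bot, bot_le, fun h => hf ((Submodule.mem_bot T).1 h)⟩
  let β' : (T ⧸ P) →ₐ[K] K := Ideal.Quotient.liftₐ P β fun a ha => hPβ ha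
  have hβ' : ∀ a : T, β' (Ideal.Quotient.mk P a) = β a := fun a => rfl
  let m : Ideal (T ⧸ P) := RingHom.ker β'
  have hm : m.IsPrime := RingHom.ker_isPrime _
  let D := Localization.AtPrime m
  have hle : m.primeCompl ≤ nonZeroDivisors (T ⧸ P) := m.primeCompl_le_nonZeroDivisors
  have hDdom : IsDomain D := IsLocalization.isDomain_localization hle
  have hDn : IsNoetherianRing D := IsLocalization.isNoetherianRing m.primeCompl _ inferInstance
  let i : (T ⧸ P) →ₐ[K] D := IsScalarTower.toAlgHom K (T ⧸ P) D
  have hi : Function.Injective i := IsLocalization.injective D hle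
  have him : ∀ a, i a ∈ maximalIdeal D ↔ β' a = 0 := fun a =>
    IsLocalization.AtPrime.to_map_mem_maximal_iff D m a
  let k : T →ₐ[K] D := i.comp (Ideal.Quotient.mkₐ K P)
  have hk : ∀ a, k a = i (Ideal.Quotient.mk P a) := fun a => rfl
  have hk0 : ∀ a, k a = 0 ↔ a ∈ P := fun a => by
    rw [hk, map_eq_zero_iff i hi, Ideal.Quotient.eq_zero_iff_mem]
  have hfrac : ∀ x : D, ∃ (t s : T), β s ≠ 0 ∧ IsUnit (k s) ∧ x * k s = k t := by
    intro x
    obtain ⟨⟨t, s⟩, hts⟩ := IsLocalization.surj m.primeCompl x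
    obtain ⟨t', rfl⟩ := Ideal.Quotient.mk_surjective t
    obtain ⟨s', hs'⟩ := Ideal.Quotient.mk_surjective (s : T ⧸ P)
    refine ⟨t', s', fun h => s.2 ?_, ?_, ?_⟩
    · rw [← hs']; exact (hβ' s').trans h
    · rw [hk, hs']; exact IsLocalization.map_units D s
    · rw [hk, hs']; exact hts
  obtain ⟨φ, hφf, hφ⟩ := exists_powerSeries_point_of_isLocalRing (K := K) (D := D) (f := k f)
    (fun x => by
      obtain ⟨t, s, hs, hsu, hx⟩ := hfrac x
      refine ⟨β t / β s, ?_⟩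
      rw [← Ideal.mul_unit_mem_iff_mem _ hsu, sub_mul, hx, ← AlgHom.commutes k, ← map_mul,
        ← map_sub, hk, him, hβ', map_sub, map_mul, AlgHom.commutes]
      simp [hs])
    (fun h => hfP ((hk0 f).1 h)) ((him _).2 hβf)
    (fun Q hQ hQ0 => by
      by_contra hfQ
      refine hQ0 ((Submodule.eq_bot_iff Q).2 fun x hx => ?_)
      have hQc : (Q.comap k).IsPrime := Ideal.comap_isPrime _ _
      have hPQ : P ≤ Q.comap k := fun a ha => by
        rw [Ideal.mem_comap, (hk0 a).2 ha]; exact zero_mem _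
      have hQβ : Q.comap k ≤ RingHom.ker β := fun a ha =>
        (him _).1 (le_maximalIdeal hQ.ne_top ha)
      have heq : P = Q.comap k := by
        by_contra hne
        exact hPmax _ ⟨hQc, hQβ, hfQ⟩ (lt_of_le_of_ne hPQ hne)
      obtain ⟨t, s, hs, hsu, hxs⟩ := hfrac x
      have : t ∈ P := by
        rw [heq, Ideal.mem_comap, ← hxs]; exact Q.mul_mem_right _ hx
      rw [(hk0 t).2 this] at hxs
      exact (hsu.mul_left_eq_zero).1 hxs)
  refine ⟨φ.comp k, hφf, fun a => ?_⟩
  have h1 : k (a - algebraMap K T (β a)) ∈ maximalIdeal D := by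
    rw [hk, him, hβ', map_sub, AlgHom.commutes]; simp
  have h2 := hφ _ h1
  rw [map_sub, map_sub, map_sub, AlgHom.commutes, AlgHom.commutes, sub_eq_zero] at h2
  rw [AlgHom.comp_apply, h2]
  simp

/-- The points in the closure of the image of a morphism are limits along formal curves: if `b`
lies in the closure of the image of the irreducible affine variety with coordinate ring `S` under
the morphism with components `r j`, then there is a point of that variety over the field of Laurent
series whose image is defined over the power series ring and specializes to `b`.
The field of Laurent series enters through an embedding `ι` of `K⟦X⟧` into a field `F`. -/
theorem exists_laurent_point {S J F : Type*} [CommRing S] [IsDomain S] [Algebra K S]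
    [Algebra.FiniteType K S] [Finite J] [Field F] [Algebra K F] (ι : K⟦X⟧ →ₐ[K] F)
    (hι : Function.Injective ι) (r : J → S) (b : J → K)
    (h : ∀ p : MvPolynomial J K, MvPolynomial.aeval r p = 0 → MvPolynomial.eval b p = 0) :
    ∃ φ : S →ₐ[K] F, ∀ j, ∃ c : K⟦X⟧, φ (r j) = ι c ∧ PowerSeries.constantCoeff c = b j := by
  classical
  let L := FractionRing S
  let i : S →ₐ[K] L := IsScalarTower.toAlgHom K S L
  have hi : Function.Injective i := IsFractionRing.injective S L
  let R : Subring L := (MvPolynomial.aeval (R := K) fun j => i (r j)).range.toSubring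
  let ρ : MvPolynomial J K →+* R := (MvPolynomial.aeval (R := K) fun j => i (r j)).rangeRestrict
  have hρval : ∀ p, (ρ p : L) = i (MvPolynomial.aeval r p) := fun p => by
    change MvPolynomial.aeval (fun j => i (r j)) p = _
    rw [← MvPolynomial.comp_aeval_apply]
  have hρ : Function.Surjective ρ := AlgHom.rangeRestrict_surjective _
  have hρb : ∀ p, ρ p = 0 → MvPolynomial.eval b p = 0 := fun p hp =>
    h p (hi (by rw [← hρval, hp, map_zero]; rfl))
  obtain ⟨B, hRB, hB⟩ := Ideal.image_subset_nonunits_valuationSubring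
    ((RingHom.ker (MvPolynomial.eval b)).map ρ) (by
      rw [Ne, Ideal.eq_top_iff_one, Ideal.mem_map_iff_of_surjective ρ hρ]
      rintro ⟨p, hp, hp1⟩
      have := hρb (p - 1) (by rw [map_sub, hp1, map_one, sub_self])
      rw [map_sub, (RingHom.mem_ker).1 hp, map_one] at this
      simp at this)
  have hKB : ∀ c : K, algebraMap K L c ∈ B := fun c => hRB
    ⟨MvPolynomial.C c, by simp⟩
  have hrB : ∀ j, i (r j) ∈ B := fun j => hRB ⟨MvPolynomial.X j, by simp⟩
  have hrb : ∀ j, i (r j) - algebraMap K L (b j) ∈ B.nonunits := fun j => by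
    refine hB ⟨ρ (MvPolynomial.X j - MvPolynomial.C (b j)), Ideal.mem_map_of_mem _ ?_, ?_⟩
    · simp [RingHom.mem_ker]
    · change (ρ _ : L) = _
      rw [hρval]
      simp [i, ← IsScalarTower.algebraMap_apply]
  obtain ⟨s, hs⟩ := (inferInstance : Algebra.FiniteType K S).out
  -- Generators outside the valuation ring are replaced by their inverses.
  let inv : S → L := fun x => if i x ∈ B then i x else (i x)⁻¹
  have hinvB : ∀ x, inv x ∈ B := fun x => by
    by_cases hx : i x ∈ B
    · simp [inv, hx]
    · simpa [inv, hx] using (B.mem_or_inv_mem (i x)).resolve_left hx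
  let T : Subalgebra K L := Algebra.adjoin K (Set.range (fun j => i (r j)) ∪ inv '' s)
  have hTfin : Algebra.FiniteType K T := (Subalgebra.fg_iff_finiteType _).1
    (Subalgebra.fg_def.2 ⟨_, (Set.finite_range _).union (s.finite_toSet.image inv), rfl⟩)
  have hTB : ∀ x ∈ T, x ∈ B := fun x hx => by
    refine Algebra.adjoin_induction ?_ hKB (fun _ _ _ _ => add_mem) (fun _ _ _ _ => mul_mem) hx
    rintro _ (⟨j, rfl⟩ | ⟨x, -, rfl⟩)
    exacts [hrB j, hinvB x]
  have hrT : ∀ j, i (r j) ∈ T := fun j => Algebra.subset_adjoin (Or.inl ⟨j, rfl⟩)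
  have hinvT : ∀ x ∈ s, inv x ∈ T := fun x hx => Algebra.subset_adjoin (Or.inr ⟨x, hx, rfl⟩)
  let τ : T →+* B := Subring.inclusion (S := T.toSubring) (T := B.toSubring) hTB
  obtain ⟨M, hM, hMle⟩ := Ideal.exists_le_maximal ((maximalIdeal B).comap τ)
    (Ideal.comap_ne_top _ (maximalIdeal.isMaximal B).ne_top)
  let : Field (T ⧸ M) := Ideal.Quotient.field M
  have hfinM : Module.Finite K (T ⧸ M) := finite_of_finite_type_of_isJacobsonRing K (T ⧸ M)
  have hint : Algebra.IsIntegral K (T ⧸ M) := Algebra.IsIntegral.of_finite K _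
  have hbij : Function.Bijective (algebraMap K (T ⧸ M)) :=
    IsAlgClosed.algebraMap_bijective_of_isIntegral
  let e : K ≃ₐ[K] (T ⧸ M) := AlgEquiv.ofBijective (Algebra.ofId K (T ⧸ M)) hbij
  let β : T →ₐ[K] K := e.symm.toAlgHom.comp (Ideal.Quotient.mkₐ K M)
  have hβr : ∀ j, β ⟨i (r j), hrT j⟩ = b j := fun j => by
    change e.symm _ = _
    rw [AlgEquiv.symm_apply_eq]
    change Ideal.Quotient.mk M _ = Ideal.Quotient.mk M (algebraMap K T (b j))
    rw [Ideal.Quotient.eq]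
    refine hMle ?_
    rw [Ideal.mem_comap]
    have : i (r j) - algebraMap K L (b j) ∈ (B.nonunits : Set L) := hrb j
    rw [← B.image_maximalIdeal] at this
    obtain ⟨z, hz, hz'⟩ := this
    convert hz
    exact Subtype.ext hz'.symm
  -- The product of the inverses that occur; after inverting it the subring contains `S`.
  let f : T := ∏ x : s, if i x ∈ B then 1 else ⟨inv x, hinvT x x.2⟩
  have hf : f ≠ 0 := Finset.prod_ne_zero_iff.2 fun x _ => by
    by_cases hx : i x ∈ B
    · simp [hx]
    · rw [if_neg hx]
      intro h0
      have h1 : inv x = 0 := congrArg Subtype.val h0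
      simp only [inv, if_neg hx, inv_eq_zero] at h1
      exact hx (h1 ▸ zero_mem _)
  obtain ⟨φ, hφf, hφ⟩ := exists_powerSeries_point β hf
  let Tf := Localization.Away f
  let ψ : Tf →ₐ[K] L := IsLocalization.liftAlgHom (M := Submonoid.powers f) (f := T.val) (by
    rintro ⟨_, n, rfl⟩
    exact IsUnit.mk0 _ fun h0 => pow_ne_zero n hf (Subtype.ext h0))
  have hψ : ∀ t : T, ψ (algebraMap T Tf t) = t := fun t => IsLocalization.lift_eq _ _
  have hψinj : Function.Injective ψ := by
    rw [injective_iff_map_eq_zero]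
    intro z hz
    obtain ⟨⟨t, y⟩, hty⟩ := IsLocalization.surj (Submonoid.powers f) z
    have h1 := congrArg ψ hty
    rw [map_mul, hz, zero_mul, hψ] at h1
    have h2 : t = 0 := Subtype.ext h1.symm
    simp only [h2, map_zero] at hty
    exact ((IsLocalization.map_units Tf y).mul_left_eq_zero).1 hty
  let χ : Tf →ₐ[K] F := IsLocalization.liftAlgHom (M := Submonoid.powers f)
    (f := ι.comp φ) (by
      rintro ⟨_, n, rfl⟩
      rw [map_pow]
      exact (IsUnit.mk0 _ fun h0 => hφf (hι (h0.trans (map_zero ι).symm))).pow n)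
  have hχ : ∀ t : T, χ (algebraMap T Tf t) = ι (φ t) := fun t => IsLocalization.lift_eq _ _
  have hrange : ∀ x : S, i x ∈ ψ.range := by
    have hsub : (⊤ : Subalgebra K S) ≤ ψ.range.comap i := by
      rw [← hs, Algebra.adjoin_le_iff]
      intro x hx
      change i x ∈ ψ.range
      by_cases hxB : i x ∈ B
      · exact ⟨algebraMap T Tf ⟨inv x, hinvT x hx⟩, (hψ _).trans (if_pos hxB)⟩
      · have hunit : IsUnit (algebraMap T Tf ⟨inv x, hinvT x hx⟩) := by
          have h1 : (⟨inv x, hinvT x hx⟩ : T) ∣ f := by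
            have := Finset.dvd_prod_of_mem (fun x : s => if i x ∈ B then (1 : T) else
              ⟨inv x, hinvT x x.2⟩) (Finset.mem_univ ⟨x, hx⟩)
            simpa only [if_neg hxB] using this
          exact isUnit_of_dvd_unit (map_dvd (algebraMap T Tf) h1)
            (IsLocalization.Away.algebraMap_isUnit f)
        obtain ⟨u, hu⟩ := hunit.exists_left_inv
        refine ⟨u, ?_⟩
        have h2 := congrArg ψ hu
        rw [map_mul, hψ, map_one] at h2
        change ψ u * inv x = 1 at h2
        simp only [inv, if_neg hxB] at h2
        have hx0 : i x ≠ 0 := fun h0 => hxB (h0 ▸ zero_mem _)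
        change ψ u = i x
        exact (mul_inv_eq_one₀ hx0).1 h2
    exact fun x => hsub (Algebra.mem_top)
  let e' : Tf ≃ₐ[K] ψ.range := AlgEquiv.ofInjective ψ hψinj
  refine ⟨χ.comp (e'.symm.toAlgHom.comp (i.codRestrict ψ.range hrange)), fun j =>
    ⟨φ ⟨i (r j), hrT j⟩, ?_, (hφ _).trans (hβr j)⟩⟩
  rw [← hχ]
  change χ (e'.symm _) = _
  congr 1
  rw [AlgEquiv.symm_apply_eq]
  exact Subtype.ext (show i (r j) = ψ _ from (hψ ⟨_, hrT j⟩).symm)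

end Curves

/-! ### Homogeneous bases and structure constants -/

section Bases

open Module

variable {ι : Type*} {R : Type*} [CommRing R]

/-- The products of the elements of the basis `x` have the coordinates
`x i * x j = ∑ k, c i j k • x k`. -/
def HasStructureConstants [Fintype ι] {X : Type*} [NonUnitalRing X] [Module R X] (x : Basis ι R X)
    (c : ι → ι → ι → R) : Prop :=
  ∀ i j, x i * x j = ∑ k, c i j k • x k

/-- The basis `x` is homogeneous for the grading `𝒳`, the element `x a` having degree `deg a`: the
component of degree `i` is spanned by the elements of the basis of degree `i`. -/
def IsHomogeneousBasis {X : Type*} [AddCommGroup X] [Module R X] (𝒳 : ℤ → Submodule R X)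
    (x : Basis ι R X) (deg : ι → ℤ) : Prop :=
  ∀ i, 𝒳 i = Submodule.span R (x '' (deg ⁻¹' {i}))

/-- The structure constants `c` are those of a multiplication of degree `0`. -/
def IsHomogeneousConst (deg : ι → ℤ) (c : ι → ι → ι → R) : Prop :=
  ∀ i j k, c i j k ≠ 0 → deg k = deg i + deg j

namespace HasStructureConstants

variable [Fintype ι] {X : Type*} [NonUnitalRing X] [Module R X] {x : Basis ι R X}
  {c : ι → ι → ι → R}

theorem repr_mul (hx : HasStructureConstants x c) (i j k : ι) : x.repr (x i * x j) k = c i j k := by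
  classical
  rw [hx, map_sum, Finsupp.finsetSum_apply]
  simp [Finsupp.single_apply]

theorem unique (hx : HasStructureConstants x c) {d : ι → ι → ι → R}
    (hd : HasStructureConstants x d) : c = d := by
  funext i j k
  rw [← hx.repr_mul, hd.repr_mul]

theorem of_repr (x : Basis ι R X) :
    HasStructureConstants x (fun i j k => x.repr (x i * x j) k) :=
  fun _ _ => (x.sum_repr _).symm

theorem assoc [IsScalarTower R X X] [SMulCommClass R X X] (hx : HasStructureConstants x c)
    (i j k m : ι) : ∑ l, c i j l * c l k m = ∑ l, c j k l * c i l m := by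
  have h1 := congrArg (fun z => x.repr z m) (mul_assoc (x i) (x j) (x k))
  simp only [hx i j, hx j k, Finset.sum_mul, Finset.mul_sum, smul_mul_assoc, mul_smul_comm,
    map_sum, map_smul, Finsupp.finsetSum_apply, Finsupp.smul_apply, hx.repr_mul, smul_eq_mul] at h1
  exact h1

theorem baseChange [IsScalarTower R X X] [SMulCommClass R X X] (hx : HasStructureConstants x c)
    (S : Type*) [CommRing S] [Algebra R S] :
    HasStructureConstants (x.baseChange S) (fun i j k => algebraMap R S (c i j k)) := by
  intro i j
  simp only [Basis.baseChange_apply, Algebra.TensorProduct.tmul_mul_tmul, hx i j, mul_one,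
    TensorProduct.tmul_sum, TensorProduct.tmul_smul, algebraMap_smul]

end HasStructureConstants

namespace IsHomogeneousBasis

variable {X : Type*} [AddCommGroup X] [Module R X] {𝒳 : ℤ → Submodule R X} {x : Basis ι R X}
  {deg : ι → ℤ}

theorem mem (h : IsHomogeneousBasis 𝒳 x deg) (a : ι) : x a ∈ 𝒳 (deg a) := by
  rw [h]
  exact Submodule.subset_span ⟨a, rfl, rfl⟩

theorem repr_eq_zero (h : IsHomogeneousBasis 𝒳 x deg) {i : ℤ} {z : X} (hz : z ∈ 𝒳 i) {a : ι}
    (ha : deg a ≠ i) : x.repr z a = 0 := by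
  rw [h, Basis.mem_span_image] at hz
  by_contra hne
  exact ha (hz (Finsupp.mem_support_iff.2 hne))

theorem baseChange (h : IsHomogeneousBasis 𝒳 x deg) (S : Type*) [CommRing S] [Algebra R S] :
    IsHomogeneousBasis (fun i => (𝒳 i).baseChange S) (x.baseChange S) deg := by
  intro i
  change (𝒳 i).baseChange S = _
  rw [h, Submodule.baseChange_span, ← Set.image_comp]
  congr 1
  refine Set.image_congr fun a _ => ?_
  simp

/-- A basis of homogeneous elements spans each component, as the sum of the components is
direct. -/
theorem of_mem (h𝒳 : iSupIndep 𝒳) (hx : ∀ a, x a ∈ 𝒳 (deg a)) : IsHomogeneousBasis 𝒳 x deg := by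
  intro i
  refine le_antisymm (fun z hz => ?_) (Submodule.span_le.2 ?_)
  · have htop : z ∈ Submodule.span R (x '' (deg ⁻¹' {i})) ⊔
        Submodule.span R (x '' (deg ⁻¹' {i})ᶜ) := by
      rw [← Submodule.span_union, ← Set.image_union, Set.union_compl_self, Set.image_univ,
        x.span_eq]
      trivial
    obtain ⟨z₁, hz₁, z₂, hz₂, rfl⟩ := Submodule.mem_sup.1 htop
    have h1 : z₁ ∈ 𝒳 i := by
      refine Submodule.span_le.2 ?_ hz₁
      rintro _ ⟨a, rfl, rfl⟩
      exact hx a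
    have h2 : z₂ ∈ ⨆ j, ⨆ (_ : j ≠ i), 𝒳 j := by
      refine Submodule.span_le.2 ?_ hz₂
      rintro _ ⟨a, ha, rfl⟩
      exact Submodule.mem_iSup_of_mem (deg a) (Submodule.mem_iSup_of_mem ha (hx a))
    have h3 : z₂ = 0 := Submodule.disjoint_def.1 (h𝒳 i) z₂
      ((Submodule.add_mem_iff_right _ h1).1 hz) h2
    rw [h3, add_zero]
    exact hz₁
  · rintro _ ⟨a, rfl, rfl⟩
    exact hx a

theorem isInternal (h : IsHomogeneousBasis 𝒳 x deg) : DirectSum.IsInternal 𝒳 := by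
  rw [DirectSum.isInternal_submodule_iff_iSupIndep_and_iSup_eq_top]
  refine ⟨fun i => ?_, ?_⟩
  · have : ⨆ j, ⨆ (_ : j ≠ i), 𝒳 j ≤ Submodule.span R (x '' (deg ⁻¹' {i})ᶜ) := by
      refine iSup₂_le fun j hj => ?_
      rw [h]
      refine Submodule.span_mono (Set.image_mono fun a ha hai => hj ?_)
      exact (show deg a = j from ha).symm.trans hai
    refine Disjoint.mono_right this ?_
    rw [h]
    exact x.linearIndependent.disjoint_span_image disjoint_compl_right
  · rw [eq_top_iff, ← x.span_eq, Submodule.span_le]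
    rintro _ ⟨a, rfl⟩
    exact Submodule.mem_iSup_of_mem (deg a) (h.mem a)

/-- A basis obtained from a homogeneous one by a homogeneous invertible matrix is homogeneous. -/
theorem change [Fintype ι] (h : IsHomogeneousBasis 𝒳 x deg) {y : Basis ι R X} {g : Matrix ι ι R}
    (hy : ∀ i, y i = ∑ a, g a i • x a) (hg : ∀ a b, deg a ≠ deg b → g a b = 0) :
    IsHomogeneousBasis 𝒳 y deg := by
  refine of_mem ((DirectSum.isInternal_submodule_iff_iSupIndep_and_iSup_eq_top _).1
    h.isInternal).1 fun i => ?_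
  rw [hy]
  refine sum_mem fun a _ => ?_
  by_cases ha : deg a = deg i
  · exact Submodule.smul_mem _ _ (ha ▸ h.mem a)
  · rw [hg a i ha, zero_smul]
    exact zero_mem _

end IsHomogeneousBasis

variable {X Y : Type*} [NonUnitalRing X] [Module R X] [NonUnitalRing Y] [Module R Y]
  {𝒳 : ℤ → Submodule R X} {𝒴 : ℤ → Submodule R Y} {x : Basis ι R X} {y : Basis ι R Y}
  {deg : ι → ℤ} {c : ι → ι → ι → R}

theorem HasStructureConstants.map [Fintype ι] (hx : HasStructureConstants x c)
    (e : GradedAlgEquiv R 𝒳 𝒴) :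
    HasStructureConstants (x.map e.toLinearEquiv) c := by
  intro i j
  simp only [Basis.map_apply, ← e.map_mul', hx i j, map_sum, map_smul]

theorem IsHomogeneousBasis.map (hx : IsHomogeneousBasis 𝒳 x deg) (e : GradedAlgEquiv R 𝒳 𝒴) :
    IsHomogeneousBasis 𝒴 (x.map e.toLinearEquiv) deg := by
  intro i
  rw [← e.map_grading', hx, Submodule.map_span, ← Set.image_comp]
  rfl

variable [Fintype ι] [IsScalarTower R X X] [SMulCommClass R X X] [IsScalarTower R Y Y]
  [SMulCommClass R Y Y]

theorem gradedMul_of_isHomogeneousConst (hx : IsHomogeneousBasis 𝒳 x deg)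
    (hc : HasStructureConstants x c) (hdeg : IsHomogeneousConst deg c) :
    SetLike.GradedMul 𝒳 := by
  refine ⟨fun {i j} z w hz hw => ?_⟩
  rw [hx] at hz hw
  refine Submodule.span_induction₂ (p := fun z w _ _ => z * w ∈ 𝒳 (i + j))
    ?_ ?_ ?_ ?_ ?_ ?_ ?_ hz hw
  · rintro _ _ ⟨a, rfl, rfl⟩ ⟨b, rfl, rfl⟩
    rw [hc]
    refine sum_mem fun k _ => ?_
    by_cases h0 : c a b k = 0
    · rw [h0, zero_smul]; exact zero_mem _
    · exact Submodule.smul_mem _ _ (hdeg a b k h0 ▸ hx.mem k)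
  · intro w _; rw [zero_mul]; exact zero_mem _
  · intro z _; rw [mul_zero]; exact zero_mem _
  · intro z₁ z₂ w _ _ _ h1 h2; rw [add_mul]; exact add_mem h1 h2
  · intro z w₁ w₂ _ _ _ h1 h2; rw [mul_add]; exact add_mem h1 h2
  · intro r z w _ _ h1; rw [smul_mul_assoc]; exact Submodule.smul_mem _ _ h1
  · intro r z w _ _ h1; rw [mul_smul_comm]; exact Submodule.smul_mem _ _ h1

/-- Graded algebras with homogeneous bases of the same degrees and the same structure constants are
isomorphic. -/
theorem nonempty_gradedAlgEquiv (hx : IsHomogeneousBasis 𝒳 x deg) (hxc : HasStructureConstants x c)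
    (hy : IsHomogeneousBasis 𝒴 y deg) (hyc : HasStructureConstants y c) :
    Nonempty (GradedAlgEquiv R 𝒳 𝒴) := by
  classical
  let e : X ≃ₗ[R] Y := x.equiv y (Equiv.refl ι)
  have he : ∀ i, e (x i) = y i := fun i => by simp [e]
  refine ⟨⟨e, fun z w => ?_, fun i => ?_⟩⟩
  · have : (LinearMap.mul R X).compr₂ (e : X →ₗ[R] Y)
        = (LinearMap.mul R Y).compl₁₂ (e : X →ₗ[R] Y) (e : X →ₗ[R] Y) := by
      refine x.ext fun i => x.ext fun j => ?_
      simp [he, hxc i j, hyc i j]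
    exact LinearMap.congr_fun₂ this z w
  · rw [hx, hy, Submodule.map_span, ← Set.image_comp]
    congr 1
    exact Set.image_congr fun a _ => he a

/-- The structure constants with respect to the basis `∑ a, g' a i • x a` of an algebra whose
structure constants with respect to `x` are `c`; here `g` is the inverse of `g'`. Equivalently,
these are the structure constants of the multiplication transported along `g`. -/
def transportConst (g g' : Matrix ι ι R) (c : ι → ι → ι → R) (i j k : ι) : R :=
  ∑ a, ∑ b, ∑ d, g' a i * g' b j * c a b d * g k d

theorem exists_basis_of_mul_eq_one {X : Type*} [AddCommGroup X] [Module R X] [DecidableEq ι]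
    (x : Basis ι R X) {g g' : Matrix ι ι R} (h : g' * g = 1) :
    ∃ y : Basis ι R X, ∀ i, y i = ∑ a, g' a i • x a :=
  ⟨x.map (Matrix.toLinearEquiv x g'
      ((Matrix.isUnit_iff_isUnit_det g').1 (IsUnit.of_mul_eq_one g h))),
    fun i => (x.map_apply _ i).trans (Matrix.toLin_self x x g' i)⟩

theorem map_transportConst {S : Type*} [CommRing S] (φ : R →+* S) (g g' : Matrix ι ι R)
    (c : ι → ι → ι → R) (i j k : ι) :
    φ (transportConst g g' c i j k) =
      transportConst (g.map φ) (g'.map φ) (fun a b d => φ (c a b d)) i j k := by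
  simp [transportConst]

theorem HasStructureConstants.change [DecidableEq ι] (hx : HasStructureConstants x c)
    {g g' : Matrix ι ι R} (hgg' : g' * g = 1) {y : Basis ι R X}
    (hy : ∀ i, y i = ∑ a, g' a i • x a) : HasStructureConstants y (transportConst g g' c) := by
  intro i j
  -- The old basis in terms of the new one.
  have hx' : ∀ d, x d = ∑ k, g k d • y k := by
    intro d
    simp only [hy, Finset.smul_sum, smul_smul]
    rw [Finset.sum_comm]
    simp only [← Finset.sum_smul]
    have : ∀ a, ∑ k, g k d * g' a k = (1 : Matrix ι ι R) a d := fun a => by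
      rw [← hgg', Matrix.mul_apply]
      exact Finset.sum_congr rfl fun _ _ => mul_comm _ _
    simp [this, Matrix.one_apply]
  rw [hy i, hy j, Finset.sum_mul]
  simp only [transportConst, Finset.sum_smul, Finset.mul_sum]
  rw [Finset.sum_comm (s := (Finset.univ : Finset ι)) (t := (Finset.univ : Finset ι))
    (f := fun k a => ∑ b, ∑ d, (g' a i * g' b j * c a b d * g k d) • y k)]
  refine Finset.sum_congr rfl fun a _ => ?_
  rw [Finset.sum_comm (s := (Finset.univ : Finset ι)) (t := (Finset.univ : Finset ι))
    (f := fun k b => ∑ d, (g' a i * g' b j * c a b d * g k d) • y k)]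
  refine Finset.sum_congr rfl fun b _ => ?_
  rw [smul_mul_assoc, mul_smul_comm, hx a b, Finset.sum_comm, Finset.smul_sum, Finset.smul_sum]
  refine Finset.sum_congr rfl fun d _ => ?_
  conv_lhs => rw [hx' d]
  simp only [Finset.smul_sum, smul_smul]
  refine Finset.sum_congr rfl fun k _ => ?_
  congr 1
  ring

theorem IsHomogeneousConst.transportConst (hc : IsHomogeneousConst deg c) {g g' : Matrix ι ι R}
    (hg : ∀ a b, deg a ≠ deg b → g a b = 0) (hg' : ∀ a b, deg a ≠ deg b → g' a b = 0) :
    IsHomogeneousConst deg (transportConst g g' c) := by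
  intro i j k hne
  obtain ⟨a, -, ha⟩ := Finset.exists_ne_zero_of_sum_ne_zero hne
  obtain ⟨b, -, hb⟩ := Finset.exists_ne_zero_of_sum_ne_zero ha
  obtain ⟨d, -, hd⟩ := Finset.exists_ne_zero_of_sum_ne_zero hb
  have h1 : deg a = deg i := by
    by_contra h; exact hd (by rw [hg' a i h]; ring)
  have h2 : deg b = deg j := by
    by_contra h; exact hd (by rw [hg' b j h]; ring)
  have h3 : deg k = deg d := by
    by_contra h; exact hd (by rw [hg k d h]; ring)
  have h4 : deg d = deg a + deg b := hc a b d fun h => hd (by rw [h]; ring)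
  rw [h3, h4, h1, h2]

/-- The inverse of a homogeneous matrix is homogeneous. -/
theorem eq_zero_of_mul_eq_one [DecidableEq ι] {g g' : Matrix ι ι R} (hgg' : g * g' = 1)
    (hg : ∀ a b, deg a ≠ deg b → g a b = 0) (a b : ι) (hab : deg a ≠ deg b) : g' a b = 0 := by
  -- A matrix is homogeneous if and only if it commutes with the projections to the components.
  let p : Matrix ι ι R := Matrix.diagonal fun k => if deg k = deg b then 1 else 0
  have hg'g : g' * g = 1 := mul_eq_one_comm.1 hgg'
  have hcomm : p * g = g * p := by
    ext i j
    simp only [p, Matrix.diagonal_mul, Matrix.mul_diagonal]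
    by_cases hij : deg i = deg j
    · rw [hij, mul_comm]
    · rw [hg i j hij]; simp
  have hcomm' : g' * p = p * g' := by
    calc g' * p = g' * (p * g) * g' := by rw [mul_assoc, mul_assoc, hgg', mul_one]
      _ = p * g' := by rw [hcomm, ← mul_assoc, hg'g, one_mul]
  have := congrFun (congrFun hcomm' a) b
  simpa [p, Matrix.diagonal_mul, Matrix.mul_diagonal, hab] using this

end Bases

/-! ### Algebras given by structure constants; complete modules -/

section StructureAlgebra

open Module

variable {ι : Type*} [Fintype ι] {R : Type*} [CommRing R]

/-- The condition on structure constants that the multiplication is associative. -/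
def IsAssociativeConst (c : ι → ι → ι → R) : Prop :=
  ∀ i j k m, ∑ l, c i j l * c l k m = ∑ l, c j k l * c i l m

/-- The algebra with structure constants `c`: a free module with a distinguished basis, whose
elements are multiplied as prescribed by `c`. -/
def StructureAlgebra {c : ι → ι → ι → R} (_hc : IsAssociativeConst c) : Type _ := ι → R

namespace StructureAlgebra

variable {c : ι → ι → ι → R} (hc : IsAssociativeConst c)

instance : AddCommGroup (StructureAlgebra hc) := inferInstanceAs (AddCommGroup (ι → R))

instance : Module R (StructureAlgebra hc) := inferInstanceAs (Module R (ι → R))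

variable [DecidableEq ι]

/-- The distinguished basis. -/
noncomputable def basis : Basis ι R (StructureAlgebra hc) := Pi.basisFun R ι

/-- The multiplication as a bilinear map. -/
noncomputable def mulHom :
    StructureAlgebra hc →ₗ[R] StructureAlgebra hc →ₗ[R] StructureAlgebra hc :=
  (basis hc).constr R fun i => (basis hc).constr R fun j => ∑ k, c i j k • basis hc k

theorem mulHom_basis (i j : ι) :
    mulHom hc (basis hc i) (basis hc j) = ∑ k, c i j k • basis hc k := by
  simp [mulHom]

theorem mulHom_assoc (x y z : StructureAlgebra hc) :
    mulHom hc (mulHom hc x y) z = mulHom hc x (mulHom hc y z) := by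
  have h (i : ι) : (mulHom hc).comp (mulHom hc (basis hc i)) =
      (mulHom hc).compr₂ (mulHom hc (basis hc i)) := by
    refine (basis hc).ext fun j => (basis hc).ext fun k => ?_
    simp only [LinearMap.comp_apply, LinearMap.compr₂_apply, mulHom_basis, map_sum, map_smul,
      LinearMap.sum_apply, LinearMap.smul_apply, Finset.smul_sum, smul_smul]
    rw [Finset.sum_comm]
    conv_rhs => rw [Finset.sum_comm]
    simp only [← Finset.sum_smul, hc i j k]
  rw [← (basis hc).sum_repr x]
  simp only [map_sum, map_smul, LinearMap.sum_apply, LinearMap.smul_apply]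
  exact Finset.sum_congr rfl fun i _ => congrArg _ (LinearMap.congr_fun₂ (h i) y z)

noncomputable instance : NonUnitalRing (StructureAlgebra hc) where
  __ := (inferInstance : AddCommGroup (StructureAlgebra hc))
  mul x y := mulHom hc x y
  left_distrib x y z := map_add (mulHom hc x) y z
  right_distrib x y z := LinearMap.map_add₂ (mulHom hc) x y z
  zero_mul x := LinearMap.map_zero₂ (mulHom hc) x
  mul_zero x := map_zero (mulHom hc x)
  mul_assoc := mulHom_assoc hc

instance : IsScalarTower R (StructureAlgebra hc) (StructureAlgebra hc) where
  smul_assoc r x y := LinearMap.map_smul₂ (mulHom hc) r x y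

instance : SMulCommClass R (StructureAlgebra hc) (StructureAlgebra hc) where
  smul_comm r x y := (map_smul (mulHom hc x) r y).symm

theorem hasStructureConstants_basis : HasStructureConstants (basis hc) c := mulHom_basis hc

/-- The grading for which the distinguished basis is homogeneous of the given degrees. -/
noncomputable def grading (deg : ι → ℤ) (i : ℤ) : Submodule R (StructureAlgebra hc) :=
  Submodule.span R (basis hc '' (deg ⁻¹' {i}))

theorem isHomogeneousBasis_basis (deg : ι → ℤ) :
    IsHomogeneousBasis (grading hc deg) (basis hc) deg := fun _ => rfl

end StructureAlgebra
end StructureAlgebra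

section Complete

variable {R : Type*} [CommRing R]

theorem mem_span_pow_smul_top {M : Type*} [AddCommGroup M] [Module R M] {ϖ : R} {n : ℕ} {z : M} :
    z ∈ (Ideal.span {ϖ} ^ n • ⊤ : Submodule R M) ↔ ∃ w, z = ϖ ^ n • w := by
  rw [Ideal.span_singleton_pow, Submodule.ideal_span_singleton_smul,
    Submodule.mem_smul_pointwise_iff_exists]
  simp [eq_comm]

theorem isAdicComplete_pi {ι : Type*} {ϖ : R} (h : IsAdicComplete (Ideal.span {ϖ}) R) :
    IsAdicComplete (Ideal.span {ϖ}) (ι → R) where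
  haus' z hz := by
    funext i
    refine IsHausdorff.haus' (I := Ideal.span {ϖ}) (z i) fun n => ?_
    obtain ⟨w, hw⟩ := mem_span_pow_smul_top.1 (SModEq.zero.1 (hz n))
    exact SModEq.zero.2 (mem_span_pow_smul_top.2 ⟨w i, congrFun hw i⟩)
  prec' f hf := by
    have (i : ι) : ∃ L, ∀ n, f n i ≡ L [SMOD (Ideal.span {ϖ} ^ n • ⊤ : Submodule R R)] := by
      refine IsPrecomplete.prec' (I := Ideal.span {ϖ}) (fun n => f n i) fun {m n} hmn => ?_
      obtain ⟨w, hw⟩ := mem_span_pow_smul_top.1 (SModEq.sub_mem.1 (hf hmn))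
      exact SModEq.sub_mem.2 (mem_span_pow_smul_top.2 ⟨w i, congrFun hw i⟩)
    choose L hL using this
    refine ⟨L, fun n => SModEq.sub_mem.2 (mem_span_pow_smul_top.2 ?_)⟩
    choose w hw using fun i => mem_span_pow_smul_top.1 (SModEq.sub_mem.1 (hL i n))
    exact ⟨w, funext hw⟩

/-- The kernel of reduction modulo `ϖ`. -/
theorem exists_eq_smul_of_one_tmul_eq_zero {k M : Type*} [CommRing k] [Algebra R k]
    [AddCommGroup M] [Module R M] (hsurj : Function.Surjective (algebraMap R k)) {ϖ : R}
    (hker : ∀ a, algebraMap R k a = 0 → ϖ ∣ a) {z : M} (hz : (1 : k) ⊗ₜ[R] z = 0) :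
    ∃ w, z = ϖ • w := by
  let l : R →ₗ[R] k := Algebra.linearMap R k
  let e : (R ⧸ LinearMap.ker l) ≃ₗ[R] k := l.quotKerEquivOfSurjective hsurj
  have he : e.symm 1 = Submodule.Quotient.mk 1 := by
    rw [LinearEquiv.symm_apply_eq]
    exact (map_one (algebraMap R k)).symm
  have h1 := congrArg (TensorProduct.quotTensorEquivQuotSMul M (LinearMap.ker l))
    (congrArg (e.symm.toLinearMap.rTensor M) hz)
  rw [LinearMap.rTensor_tmul, map_zero, map_zero, LinearEquiv.coe_coe, he] at h1
  have h2 : Submodule.Quotient.mk z =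
      (0 : M ⧸ ((LinearMap.ker l : Ideal R) • ⊤ : Submodule R M)) := by
    rw [← h1]
    erw [TensorProduct.quotTensorEquivQuotSMul_mk_tmul]
    rw [one_smul]
  rw [Submodule.Quotient.mk_eq_zero] at h2
  have h3 : (LinearMap.ker l : Ideal R) ≤ Ideal.span {ϖ} := fun a ha =>
    Ideal.mem_span_singleton.2 (hker a ha)
  have h4 := Submodule.smul_mono_left h3 h2
  rw [Submodule.ideal_span_singleton_smul, Submodule.mem_smul_pointwise_iff_exists] at h4
  obtain ⟨w, -, hw⟩ := h4
  exact ⟨w, hw.symm⟩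

open Module

/-- A basis of the reduction modulo `ϖ` of a complete torsion-free module lifts to a basis. -/
theorem exists_basis_of_complete {k M ι : Type*} [Finite ι] [IsDomain R] [CommRing k] [Algebra R k]
    [AddCommGroup M] [Module R M] (hsurj : Function.Surjective (algebraMap R k)) {ϖ : R}
    (hϖ : ϖ ≠ 0) (hker : ∀ a, algebraMap R k a = 0 ↔ ϖ ∣ a)
    (hR : IsAdicComplete (Ideal.span {ϖ}) R) (hM : IsAdicComplete (Ideal.span {ϖ}) M)
    (htf : Module.IsTorsionFree R M) (v : Basis ι k (k ⊗[R] M)) (y : ι → M)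
    (hy : ∀ i, (1 : k) ⊗ₜ[R] y i = v i) : ∃ b : Basis ι R M, ∀ i, b i = y i := by
  cases nonempty_fintype ι
  have hRι := isAdicComplete_pi (ι := ι) hR
  let L : (ι → R) →ₗ[R] M := Fintype.linearCombination R y
  have hL : ∀ f, L f = ∑ i, f i • y i := fun f => Fintype.linearCombination_apply R y f
  have hL1 : ∀ f, (1 : k) ⊗ₜ[R] L f = ∑ i, algebraMap R k (f i) • v i := fun f => by
    simp only [hL, TensorProduct.tmul_sum, TensorProduct.tmul_smul, ← hy, algebraMap_smul]
  have hsurjL : Function.Surjective L := by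
    apply surjective_of_mkQ_comp_surjective (I := Ideal.span {ϖ})
    intro z
    obtain ⟨z, rfl⟩ := Submodule.Quotient.mk_surjective _ z
    choose f hf using fun i => hsurj (v.repr ((1 : k) ⊗ₜ[R] z) i)
    have h0 : (1 : k) ⊗ₜ[R] (L f - z) = 0 := by
      rw [TensorProduct.tmul_sub, hL1, sub_eq_zero]
      simp only [hf]
      exact v.sum_repr _
    obtain ⟨w, hw⟩ := exists_eq_smul_of_one_tmul_eq_zero hsurj (fun a => (hker a).1) h0
    refine ⟨f, (Submodule.Quotient.eq _).2 ?_⟩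
    rw [hw]
    exact Submodule.smul_mem_smul (Ideal.mem_span_singleton_self ϖ) trivial
  have hinjL : Function.Injective L := by
    rw [injective_iff_map_eq_zero]
    -- A relation can be divided by `ϖ`, since it reduces to a relation in the basis `v`.
    have key : ∀ n : ℕ, ∀ f, L f = 0 → ∀ i, ϖ ^ n ∣ f i := by
      intro n
      induction n with
      | zero => simp
      | succ n ih =>
        intro f hf i
        have h1 := hL1 f
        rw [hf, TensorProduct.tmul_zero] at h1
        have h2 := fun i => (hker _).1 
          (Fintype.linearIndependent_iff.1 v.linearIndependent _ h1.symm i)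
        choose f' hf' using h2
        have h3 : ϖ • L f' = 0 := by
          rw [← map_smul, ← hf]
          congr 1
          exact funext fun i => (hf' i).symm
        rw [hf', pow_succ']
        exact mul_dvd_mul_left _ (ih f' ((smul_eq_zero.1 h3).resolve_left hϖ) i)
    intro f hf
    refine IsHausdorff.haus' (I := Ideal.span {ϖ}) f fun n =>
      SModEq.zero.2 (mem_span_pow_smul_top.2 ?_)
    choose w hw using fun i => key n f hf i
    exact ⟨w, funext hw⟩
  refine ⟨Basis.ofEquivFun (LinearEquiv.ofBijective L ⟨hinjL, hsurjL⟩).symm, fun i => ?_⟩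
  classical
  rw [Basis.coe_ofEquivFun]
  change L (Pi.single i 1) = y i
  simp [hL, Pi.single_apply]

end Complete

/-! ### The generic point of an orbit -/

section GenericTransport

open Module

variable {K : Type*} [Field K] {ι : Type*} [Fintype ι] [DecidableEq ι] (deg : ι → ℤ)

/-- The generic homogeneous matrix of degree `0`. -/
noncomputable def genericMatrix (K : Type*) [Field K] : Matrix ι ι (MvPolynomial (ι × ι) K) :=
  Matrix.of fun a b => if deg a = deg b then MvPolynomial.X (a, b) else 0

theorem det_genericMatrix_ne_zero : (genericMatrix deg K).det ≠ 0 := by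
  intro h
  have h1 := congrArg (MvPolynomial.eval fun t : ι × ι => (1 : Matrix ι ι K) t.1 t.2) h
  rw [map_zero, RingHom.map_det] at h1
  have h2 : (MvPolynomial.eval fun t : ι × ι => (1 : Matrix ι ι K) t.1 t.2).mapMatrix
      (genericMatrix deg K) = 1 := by
    ext a b
    by_cases hab : a = b
    · subst hab; simp [genericMatrix]
    · by_cases hd : deg a = deg b <;> simp [genericMatrix, hab, hd]
  rw [h2, Matrix.det_one] at h1
  exact one_ne_zero h1

/-- The coordinate ring of the group of invertible homogeneous matrices of degree `0`. -/
abbrev GenericRing (K : Type*) [Field K] : Type _ := Localization.Away (genericMatrix deg K).det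

instance : IsDomain (GenericRing deg K) :=
  IsLocalization.isDomain_localization
    (powers_le_nonZeroDivisors_of_noZeroDivisors (det_genericMatrix_ne_zero deg))

instance : Algebra.FiniteType K (GenericRing deg K) :=
  have : Algebra.FiniteType (MvPolynomial (ι × ι) K) (GenericRing deg K) :=
    IsLocalization.finiteType_of_monoid_fg (Submonoid.powers (genericMatrix deg K).det) _
  Algebra.FiniteType.trans (S := MvPolynomial (ι × ι) K) inferInstance this

/-- The generic invertible homogeneous matrix of degree `0`. -/
noncomputable def genericUnit (K : Type*) [Field K] : Matrix ι ι (GenericRing deg K) :=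
  (genericMatrix deg K).map (algebraMap _ _)

theorem isUnit_det_genericUnit : IsUnit (genericUnit deg K).det := by
  have : (genericUnit deg K).det = algebraMap _ (GenericRing deg K) (genericMatrix deg K).det :=
    (RingHom.map_det (algebraMap _ (GenericRing deg K)) (genericMatrix deg K)).symm
  rw [this]
  exact IsLocalization.Away.algebraMap_isUnit _

theorem genericUnit_eq_zero (a b : ι) (hab : deg a ≠ deg b) : genericUnit deg K a b = 0 := by
  simp [genericUnit, genericMatrix, hab]

/-- The structure constants obtained from `α` by the transport along the generic invertible
homogeneous matrix of degree `0`: the comorphism of the orbit map. -/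
noncomputable def genericConst (α : ι → ι → ι → K) (t : ι × ι × ι) : GenericRing deg K :=
  transportConst (genericUnit deg K) (genericUnit deg K)⁻¹
    (fun a b d => algebraMap K (GenericRing deg K) (α a b d)) t.1 t.2.1 t.2.2

variable {deg}

theorem map_genericConst {F : Type*} [CommRing F] [Algebra K F] (χ : GenericRing deg K →ₐ[K] F)
    (α : ι → ι → ι → K) (t : ι × ι × ι) :
    χ (genericConst deg α t) = transportConst ((genericUnit deg K).map χ)
      ((genericUnit deg K)⁻¹.map χ) (fun a b d => algebraMap K F (α a b d)) t.1 t.2.1 t.2.2 := by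
  have := map_transportConst (χ : GenericRing deg K →+* F) (genericUnit deg K)
    (genericUnit deg K)⁻¹ (fun a b d => algebraMap K (GenericRing deg K) (α a b d))
    t.1 t.2.1 t.2.2
  simpa [genericConst] using this

theorem map_genericUnit_mul_inv {F : Type*} [CommRing F] [Algebra K F]
    (χ : GenericRing deg K →ₐ[K] F) :
    (genericUnit deg K).map χ * (genericUnit deg K)⁻¹.map χ = 1 := by
  rw [← Matrix.map_mul, Matrix.mul_nonsing_inv _ (isUnit_det_genericUnit deg)]
  exact Matrix.map_one _ (map_zero χ) (map_one χ)

/-- The points of the coordinate ring are the invertible homogeneous matrices. -/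
theorem exists_specialization {F : Type*} [CommRing F] [Algebra K F] {g g' : Matrix ι ι F}
    (hg : ∀ a b, deg a ≠ deg b → g a b = 0) (hgg' : g * g' = 1) :
    ∃ χ : GenericRing deg K →ₐ[K] F, (genericUnit deg K).map χ = g ∧
      (genericUnit deg K)⁻¹.map χ = g' := by
  let ev : MvPolynomial (ι × ι) K →ₐ[K] F := MvPolynomial.aeval fun t => g t.1 t.2
  have hev : (genericMatrix deg K).map ev = g := by
    ext a b
    by_cases hab : deg a = deg b
    · simp [genericMatrix, ev, hab]
    · simp [genericMatrix, hab, hg a b hab]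
  have hdet : IsUnit (ev (genericMatrix deg K).det) := by
    have : ev (genericMatrix deg K).det = g.det := by
      rw [AlgHom.map_det]
      exact congrArg Matrix.det hev
    rw [this]
    exact (Matrix.isUnit_iff_isUnit_det g).1 (IsUnit.of_mul_eq_one g' hgg')
  let χ : GenericRing deg K →ₐ[K] F := IsLocalization.liftAlgHom
    (M := Submonoid.powers (genericMatrix deg K).det) (f := ev) (by
      rintro ⟨_, n, rfl⟩
      rw [map_pow]
      exact hdet.pow n)
  have hχ : (genericUnit deg K).map χ = g := by
    rw [← hev]
    ext a b
    exact IsLocalization.lift_eq _ _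
  refine ⟨χ, hχ, ?_⟩
  have h1 := map_genericUnit_mul_inv χ
  rw [hχ] at h1
  calc (genericUnit deg K)⁻¹.map χ = g' * g * (genericUnit deg K)⁻¹.map χ := by
        rw [mul_eq_one_comm.1 hgg', one_mul]
    _ = g' := by rw [mul_assoc, h1, mul_one]

/-- A regular function on the group of invertible homogeneous matrices is determined by its values
at the rational points. -/
theorem eq_zero_of_forall_specialization [Infinite K] {s : GenericRing deg K}
    (hs : ∀ χ : GenericRing deg K →ₐ[K] K, χ s = 0) : s = 0 := by
  obtain ⟨⟨q, d⟩, hq⟩ := IsLocalization.surj (Submonoid.powers (genericMatrix deg K).det) s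
  -- The numerator times the determinant vanishes on all of affine space.
  have h0 : q * (genericMatrix deg K).det = 0 := by
    refine MvPolynomial.funext fun x => ?_
    rw [map_mul, map_zero]
    by_cases hx : MvPolynomial.eval x (genericMatrix deg K).det = 0
    · rw [hx, mul_zero]
    · let χ : GenericRing deg K →ₐ[K] K := IsLocalization.liftAlgHom
        (M := Submonoid.powers (genericMatrix deg K).det) (f := MvPolynomial.aeval x) (by
          rintro ⟨_, n, rfl⟩
          rw [map_pow]
          exact (IsUnit.mk0 _ (by simpa [MvPolynomial.aeval_eq_eval] using hx)).pow n)
      have h1 := congrArg χ hq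
      rw [map_mul, hs, zero_mul] at h1
      have h2 : χ (algebraMap _ _ q) = MvPolynomial.aeval x q := IsLocalization.lift_eq _ _
      rw [h2, MvPolynomial.aeval_eq_eval] at h1
      have h3 : MvPolynomial.eval x q = 0 := h1.symm
      rw [h3, zero_mul]
  have hq0 := (mul_eq_zero.1 h0).resolve_right (det_genericMatrix_ne_zero deg)
  simp only [hq0, map_zero] at hq
  exact ((IsLocalization.map_units (GenericRing deg K) d).mul_left_eq_zero).1 hq

end GenericTransport

section Orbit

open Module

variable {K : Type*} [Field K] {V : Type*} [AddCommGroup V] [Module K V] {𝒱 : ℤ → Submodule K V}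
  {ι : Type*} [Fintype ι]

/-- The structure constants of a bilinear multiplication with respect to the basis `v`, as a point
of affine space. -/
noncomputable def constPoint (v : Basis ι K V) (φ : V ⊗[K] V →ₗ[K] V) (t : ι × ι × ι) : K :=
  v.repr (φ (v t.1 ⊗ₜ[K] v t.2.1)) t.2.2

/-- A basis of `V` as a basis of the algebra with underlying vector space `V`. -/
def algBasis (A : GradedAss 𝒱) (v : Basis ι K V) : Basis ι K (GradedAss.Alg A) := v

theorem hasStructureConstants_algBasis (A : GradedAss 𝒱) (v : Basis ι K V) :
    HasStructureConstants (algBasis A v) fun i j k => constPoint v A.1 (i, j, k) :=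
  HasStructureConstants.of_repr (algBasis A v)

variable [DecidableEq ι]

/-- The Zariski closure may be computed in the coordinates given by structure constants. -/
theorem mem_zariskiClosure_iff (v : Basis ι K V) {S : Set (GradedAss 𝒱)} {ψ : GradedAss 𝒱} :
    ψ ∈ zariskiClosure S ↔ ∀ p : MvPolynomial (ι × ι × ι) K,
      (∀ φ ∈ S, MvPolynomial.eval (constPoint v φ.1) p = 0) →
        MvPolynomial.eval (constPoint v ψ.1) p = 0 := by
  constructor
  · intro h p hp
    let x : ι × ι × ι → Dual K (V ⊗[K] V →ₗ[K] V) := fun t =>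
      v.coord t.2.2 ∘ₗ LinearMap.applyₗ (v t.1 ⊗ₜ[K] v t.2.1)
    have hx : ∀ φ : V ⊗[K] V →ₗ[K] V, MvPolynomial.eval (fun ξ : Dual K _ => ξ φ)
        (MvPolynomial.rename x p) = MvPolynomial.eval (constPoint v φ) p := fun φ => by
      rw [MvPolynomial.eval_rename]; rfl
    rw [← hx]
    exact h _ fun φ hφ => (hx φ.1).trans (hp φ hφ)
  · intro h p hp
    let E : ι × ι × ι → (V ⊗[K] V →ₗ[K] V) := fun t =>
      ((v.tensorProduct v).coord (t.1, t.2.1)).smulRight (v t.2.2)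
    have hE : ∀ φ : V ⊗[K] V →ₗ[K] V, φ = ∑ t, constPoint v φ t • E t := fun φ => by
      refine (v.tensorProduct v).ext fun ⟨i, j⟩ => ?_
      have h1 : ∀ t, (constPoint v φ t • E t) (v.tensorProduct v (i, j)) =
          if (i, j) = (t.1, t.2.1) then constPoint v φ t • v t.2.2 else 0 := fun t => by
        rw [LinearMap.smul_apply, LinearMap.smulRight_apply, Basis.coord_apply, Basis.repr_self,
          Finsupp.single_apply]
        split_ifs <;> simp
      rw [LinearMap.sum_apply, Finset.sum_congr rfl fun t _ => h1 t, Fintype.sum_prod_type,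
        Fintype.sum_eq_single i, Fintype.sum_prod_type, Fintype.sum_eq_single j]
      · simp only [if_true, constPoint, Basis.tensorProduct_apply]
        exact (v.sum_repr _).symm
      · intro b hb
        simp [hb.symm]
      · intro a ha
        simp [ha.symm]
    let q : MvPolynomial (ι × ι × ι) K := MvPolynomial.bind₁
      (fun ξ : Dual K (V ⊗[K] V →ₗ[K] V) => ∑ t, MvPolynomial.C (ξ (E t)) * MvPolynomial.X t) p
    have hq : ∀ φ : V ⊗[K] V →ₗ[K] V, MvPolynomial.eval (constPoint v φ) q =
        MvPolynomial.eval (fun ξ : Dual K _ => ξ φ) p := fun φ => by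
      simp only [q]
      rw [← MvPolynomial.aeval_eq_eval, MvPolynomial.aeval_bind₁, MvPolynomial.aeval_eq_eval]
      congr 2
      funext ξ
      conv_rhs => rw [hE φ]
      simp [map_sum, mul_comm]
    rw [← hq]
    exact h q fun φ hφ => (hq φ.1).trans (hp φ hφ)

/-- The closure of an orbit is stable under the group. -/
theorem smul_mem_zariskiClosure_orbit {A B : GradedAss 𝒱}
    (hB : B ∈ zariskiClosure (MulAction.orbit (GradedGL 𝒱) A)) (g : GradedGL 𝒱) :
    g • B ∈ zariskiClosure (MulAction.orbit (GradedGL 𝒱) A) := by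
  intro p hp
  let L : (V ⊗[K] V →ₗ[K] V) →ₗ[K] (V ⊗[K] V →ₗ[K] V) :=
    { toFun := transport g.1
      map_add' := fun φ ψ => TensorProduct.ext' fun x y => by simp
      map_smul' := fun r φ => TensorProduct.ext' fun x y => by simp }
  have hL : ∀ φ : GradedAss 𝒱, MvPolynomial.eval (fun ξ : Dual K _ => ξ φ.1)
      (MvPolynomial.rename (fun ξ : Dual K _ => ξ ∘ₗ L) p) =
        MvPolynomial.eval (fun ξ : Dual K _ => ξ (g • φ).1) p := fun φ => by
    rw [MvPolynomial.eval_rename]; rfl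
  rw [← hL]
  refine hB _ fun φ hφ => (hL φ).trans (hp _ ?_)
  obtain ⟨h, rfl⟩ := hφ
  exact ⟨g * h, mul_smul g h A⟩

/-- It suffices that `B` itself lies in the closure, which is stable under the group. -/
theorem isGradedDegeneration_iff {A B : GradedAss 𝒱} :
    IsGradedDegeneration B A ↔ B ∈ zariskiClosure (MulAction.orbit (GradedGL 𝒱) A) := by
  refine ⟨fun h => h (MulAction.mem_orbit_self B), ?_⟩
  rintro hB _ ⟨g, rfl⟩
  exact smul_mem_zariskiClosure_orbit hB g

/-- The action in coordinates. -/
theorem constPoint_smul (A : GradedAss 𝒱) (v : Basis ι K V) (g : GradedGL 𝒱) :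
    constPoint v (g • A).1 = fun t => transportConst (LinearMap.toMatrix v v g.1)
      (LinearMap.toMatrix v v (g⁻¹).1) (fun i j k => constPoint v A.1 (i, j, k))
        t.1 t.2.1 t.2.2 := by
  have hinv : ∀ x : V, (g⁻¹).1 (g.1 x) = x := fun x => g.1.symm_apply_apply x
  -- In the basis `g⁻¹ (v i)` the algebra `A` has the structure constants of `g • A` in `v`.
  let y : Basis ι K V := v.map (g⁻¹).1
  have hy : ∀ i, y i = (g⁻¹).1 (v i) := fun i => v.map_apply _ i
  have h1 : HasStructureConstants (algBasis A y) fun i j k => constPoint v (g • A).1 (i, j, k) := by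
    intro i j
    have h2 : ∑ k, constPoint v (g • A).1 (i, j, k) • v k =
        g.1 (A.1 ((g⁻¹).1 (v i) ⊗ₜ[K] (g⁻¹).1 (v j))) :=
      v.sum_repr ((g • A).1 (v i ⊗ₜ[K] v j))
    have h3 : A.1 (y i ⊗ₜ[K] y j) = ∑ k, constPoint v (g • A).1 (i, j, k) • y k := by
      simp only [hy]
      rw [← hinv (A.1 _), ← h2, map_sum]
      simp only [map_smul]
    exact h3
  have h4 := (hasStructureConstants_algBasis A v).change
    (g := LinearMap.toMatrix v v g.1) (g' := LinearMap.toMatrix v v (g⁻¹).1) (y := algBasis A y)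
    (by
      rw [← LinearMap.toMatrix_comp v v v, ← LinearMap.toMatrix_id v]
      congr 1
      exact LinearMap.ext hinv)
    (fun i => by
      simp only [LinearMap.toMatrix_apply]
      exact (v.sum_repr ((g⁻¹).1 (v i))).symm)
  have h5 := h1.unique h4
  funext t
  exact congrFun (congrFun (congrFun h5 t.1) t.2.1) t.2.2

theorem toMatrix_eq_zero {v : Basis ι K V} {deg : ι → ℤ} (hv : IsHomogeneousBasis 𝒱 v deg)
    (g : GradedGL 𝒱) (a b : ι) (hab : deg a ≠ deg b) : LinearMap.toMatrix v v g.1 a b = 0 := by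
  rw [LinearMap.toMatrix_apply]
  exact hv.repr_eq_zero ((g.2 _ _).2 (hv.mem b)) hab

/-- Every invertible homogeneous matrix is the matrix of an automorphism of degree `0`. -/
theorem exists_gradedGL {v : Basis ι K V} {deg : ι → ℤ} (hv : IsHomogeneousBasis 𝒱 v deg)
    {g g' : Matrix ι ι K} (hg : ∀ a b, deg a ≠ deg b → g a b = 0) (hgg' : g * g' = 1) :
    ∃ h : GradedGL 𝒱, LinearMap.toMatrix v v h.1 = g ∧ LinearMap.toMatrix v v (h⁻¹).1 = g' := by
  have hg'g : g' * g = 1 := mul_eq_one_comm.1 hgg'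
  have hmem : ∀ m : Matrix ι ι K, (∀ a b, deg a ≠ deg b → m a b = 0) →
      ∀ i, ∀ x ∈ 𝒱 i, Matrix.toLin v v m x ∈ 𝒱 i := by
    intro m hm i x hx
    have : 𝒱 i ≤ (𝒱 i).comap (Matrix.toLin v v m) := by
      conv_lhs => rw [hv i]
      rw [Submodule.span_le]
      rintro _ ⟨b, rfl, rfl⟩
      change Matrix.toLin v v m (v b) ∈ 𝒱 (deg b)
      rw [Matrix.toLin_self]
      refine sum_mem fun a _ => ?_
      by_cases hab : deg a = deg b
      · exact Submodule.smul_mem _ _ (hab ▸ hv.mem a)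
      · rw [hm a b hab, zero_smul]
        exact zero_mem _
    exact this hx
  let e : V ≃ₗ[K] V := LinearEquiv.ofLinearMap (Matrix.toLin v v g) (Matrix.toLin v v g')
    (by rw [← Matrix.toLin_mul, hgg', Matrix.toLin_one])
    (by rw [← Matrix.toLin_mul, hg'g, Matrix.toLin_one])
  have he : ∀ i x, e x ∈ 𝒱 i ↔ x ∈ 𝒱 i := fun i x => by
    refine ⟨fun h => ?_, hmem g hg i x⟩
    rw [← e.symm_apply_apply x]
    exact hmem g' (eq_zero_of_mul_eq_one hgg' hg) i _ h
  exact ⟨⟨e, he⟩, LinearMap.toMatrix_toLin v v g, LinearMap.toMatrix_toLin v v g'⟩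

/-- The polynomials vanishing on the orbit of `A` are those vanishing at the generic point of the
orbit. -/
theorem forall_mem_orbit_iff [Infinite K] {v : Basis ι K V} {deg : ι → ℤ}
    (hv : IsHomogeneousBasis 𝒱 v deg) (A : GradedAss 𝒱) (p : MvPolynomial (ι × ι × ι) K) :
    (∀ φ ∈ MulAction.orbit (GradedGL 𝒱) A, MvPolynomial.eval (constPoint v φ.1) p = 0) ↔
      MvPolynomial.aeval (genericConst deg fun i j k => constPoint v A.1 (i, j, k)) p = 0 := by
  have key : ∀ χ : GenericRing deg K →ₐ[K] K, ∀ g : GradedGL 𝒱,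
      (genericUnit deg K).map χ = LinearMap.toMatrix v v g.1 →
      (genericUnit deg K)⁻¹.map χ = LinearMap.toMatrix v v (g⁻¹).1 →
      χ (MvPolynomial.aeval (genericConst deg fun i j k => constPoint v A.1 (i, j, k)) p) =
        MvPolynomial.eval (constPoint v (g • A).1) p := by
    intro χ g h1 h2
    rw [MvPolynomial.comp_aeval_apply, MvPolynomial.aeval_eq_eval]
    congr 2
    funext t
    rw [map_genericConst, h1, h2, constPoint_smul]
    rfl
  constructor
  · intro h
    refine eq_zero_of_forall_specialization fun χ => ?_
    obtain ⟨g, h1, h2⟩ := exists_gradedGL hv (g := (genericUnit deg K).map χ)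
      (fun a b hab => by rw [Matrix.map_apply, genericUnit_eq_zero deg a b hab, map_zero])
      (map_genericUnit_mul_inv χ)
    rw [key χ g h1.symm h2.symm]
    exact h _ ⟨g, rfl⟩
  · rintro h _ ⟨g, rfl⟩
    obtain ⟨χ, h1, h2⟩ := exists_specialization (K := K) (toMatrix_eq_zero hv g)
      (g' := LinearMap.toMatrix v v (g⁻¹).1) (by
        rw [← LinearMap.toMatrix_comp v v v, ← LinearMap.toMatrix_id v]
        congr 1
        exact LinearMap.ext g.1.apply_symm_apply)
    have := key χ g h1 h2
    rw [h, map_zero] at this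
    exact this.symm

end Orbit

/-! ### Deformations and degenerations -/

section Correspondence

open Module

theorem exists_isHomogeneousBasis {K : Type u} [Field K] {V : Type v} [AddCommGroup V] [Module K V]
    [FiniteDimensional K V] {𝒱 : ℤ → Submodule K V} (h𝒱 : DirectSum.IsInternal 𝒱) :
    ∃ (ι : Type v) (_ : Fintype ι) (v : Basis ι K V) (deg : ι → ℤ), IsHomogeneousBasis 𝒱 v deg := by
  let b := h𝒱.collectedBasis fun i => Free.chooseBasis K (𝒱 i)
  have := Module.Finite.finite_basis b
  exact ⟨_, Fintype.ofFinite _, b, Sigma.fst, IsHomogeneousBasis.of_mem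
    ((DirectSum.isInternal_submodule_iff_iSupIndep_and_iSup_eq_top _).1 h𝒱).1
    (h𝒱.collectedBasis_mem _)⟩

variable {K : Type u} [Field K] {V : Type v} [AddCommGroup V] [Module K V]
  {𝒱 : ℤ → Submodule K V} {ι : Type v} {v : Basis ι K V} {deg : ι → ℤ}

theorem isHomogeneousBasis_algBasis (hv : IsHomogeneousBasis 𝒱 v deg) (A : GradedAss 𝒱) :
    IsHomogeneousBasis (GradedAss.grading A) (algBasis A v) deg := hv

theorem isHomogeneousConst_constPoint (hv : IsHomogeneousBasis 𝒱 v deg) (A : GradedAss 𝒱) :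
    IsHomogeneousConst deg fun i j k => constPoint v A.1 (i, j, k) := fun i j k h => by
  by_contra hne
  exact h (hv.repr_eq_zero (A.2.2 _ _ _ (hv.mem i) _ (hv.mem j)) hne)

variable [Fintype ι]

section Residue

attribute [local instance] residueAlgebra

/-- Homogeneous associative structure constants over `K⟦X⟧` that specialize at `0` to those of `B`
define a graded formal deformation of `B`. -/
noncomputable def formalDeformation [DecidableEq ι] (hv : IsHomogeneousBasis 𝒱 v deg)
    (B : GradedAss 𝒱)
    {c : ι → ι → ι → K⟦X⟧} (hc : IsAssociativeConst c) (hdeg : IsHomogeneousConst deg c)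
    (hB : ∀ i j k, PowerSeries.constantCoeff (c i j k) = constPoint v B.1 (i, j, k)) :
    GradedFormalDeformation.{u, v, max u v} K (GradedAss.Alg B) (GradedAss.grading B) where
  carrier := StructureAlgebra hc
  grading := StructureAlgebra.grading hc deg
  isInternal := (StructureAlgebra.isHomogeneousBasis_basis hc deg).isInternal
  gradedMul := gradedMul_of_isHomogeneousConst (StructureAlgebra.isHomogeneousBasis_basis hc deg)
    (StructureAlgebra.hasStructureConstants_basis hc) hdeg
  complete := isAdicComplete_pi (ι := ι) (R := K⟦X⟧) inferInstance
  torsionFree := inferInstanceAs (Module.IsTorsionFree K⟦X⟧ (ι → K⟦X⟧))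
  specialization := Nonempty.some (nonempty_gradedAlgEquiv
    ((StructureAlgebra.isHomogeneousBasis_basis hc deg).baseChange K)
    (c := fun i j k => constPoint v B.1 (i, j, k)) (by
      have := (StructureAlgebra.hasStructureConstants_basis hc).baseChange K
      have h : (fun i j k => algebraMap K⟦X⟧ K (c i j k)) =
          fun i j k => constPoint v B.1 (i, j, k) :=
        funext fun i => funext fun j => funext fun k => hB i j k
      rwa [h] at this)
    (isHomogeneousBasis_algBasis hv B) (hasStructureConstants_algBasis B v))

/-- Every graded formal deformation of `B` is, as an algebra, free with a homogeneous basis that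
lifts a given one, and its structure constants specialize to those of `B`. -/
theorem GradedFormalDeformation.exists_basis (hv : IsHomogeneousBasis 𝒱 v deg) {B : GradedAss 𝒱}
    (X : GradedFormalDeformation.{u, v, w} K (GradedAss.Alg B) (GradedAss.grading B)) :
    ∃ (y : Basis ι K⟦X⟧ X.carrier) (c : ι → ι → ι → K⟦X⟧), IsHomogeneousBasis X.grading y deg ∧
      HasStructureConstants y c ∧
      ∀ i j k, PowerSeries.constantCoeff (c i j k) = constPoint v B.1 (i, j, k) := by
  have hsurj : Function.Surjective (algebraMap K⟦X⟧ K) := PowerSeries.constantCoeff_surj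
  let e := X.specialization
  let w : Basis ι K (K ⊗[K⟦X⟧] X.carrier) := (algBasis B v).map e.toLinearEquiv.symm
  have hew : ∀ a, e.toLinearEquiv (w a) = algBasis B v a := fun a => by simp [w]
  have hlift : ∀ a, ∃ z ∈ X.grading (deg a), (1 : K) ⊗ₜ[K⟦X⟧] z = w a := by
    intro a
    have h1 : algBasis B v a ∈ ((X.grading (deg a)).baseChange K).map
        (e.toLinearEquiv : (K ⊗[K⟦X⟧] X.carrier) →ₗ[K] GradedAss.Alg B) := by
      rw [e.map_grading']
      exact (isHomogeneousBasis_algBasis hv B).mem a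
    obtain ⟨z, hz, hza⟩ := h1
    have hzw : z = w a := e.toLinearEquiv.injective (hza.trans (hew a).symm)
    rw [← hzw]
    rw [SetLike.mem_coe, Submodule.baseChange_eq_span] at hz
    refine Submodule.span_induction (p := fun z _ => ∃ z' ∈ X.grading (deg a),
      (1 : K) ⊗ₜ[K⟦X⟧] z' = z) ?_ ⟨0, zero_mem _, TensorProduct.tmul_zero _ _⟩ ?_ ?_ hz
    · rintro _ ⟨z', hz', rfl⟩
      exact ⟨z', hz', rfl⟩
    · rintro _ _ _ _ ⟨z₁, h₁, rfl⟩ ⟨z₂, h₂, rfl⟩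
      exact ⟨z₁ + z₂, add_mem h₁ h₂, TensorProduct.tmul_add _ _ _⟩
    · rintro r _ _ ⟨z₁, h₁, rfl⟩
      obtain ⟨f, rfl⟩ := hsurj r
      exact ⟨f • z₁, Submodule.smul_mem _ _ h₁, by
        rw [TensorProduct.tmul_smul, algebraMap_smul]⟩
  choose y hyg hy using hlift
  obtain ⟨b, hb⟩ := exists_basis_of_complete hsurj PowerSeries.X_ne_zero
    (fun a => PowerSeries.X_dvd_iff.symm) inferInstance X.complete X.torsionFree w y hy
  refine ⟨b, _, ?_, HasStructureConstants.of_repr b, fun i j k => ?_⟩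
  · refine IsHomogeneousBasis.of_mem ((DirectSum.isInternal_submodule_iff_iSupIndep_and_iSup_eq_top
      _).1 X.isInternal).1 fun a => ?_
    rw [hb]
    exact hyg a
  · have h1 := (HasStructureConstants.of_repr b).baseChange K
    have h2 : b.baseChange K = w := Basis.eq_of_apply_eq fun a => by
      rw [Basis.baseChange_apply, hb, hy]
    rw [h2] at h1
    have h3 := h1.map e
    have h4 : w.map e.toLinearEquiv = algBasis B v := Basis.eq_of_apply_eq hew
    rw [h4] at h3
    exact congrFun (congrFun (congrFun (h3.unique (hasStructureConstants_algBasis B v)) i) j) k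

end Residue

variable [DecidableEq ι] (F : Type*) [Field F] [Algebra K F] [Algebra K⟦X⟧ F]
  [IsScalarTower K K⟦X⟧ F]

/-- A point in the closure of the orbit of `A` has a formal deformation with generic fibre `A`. The
field `F` is the field of Laurent series; only an embedding of `K⟦X⟧` into it matters. -/
theorem exists_formalDeformation_of_mem_closure [IsAlgClosed K]
    (hF : Function.Injective (algebraMap K⟦X⟧ F)) (hv : IsHomogeneousBasis 𝒱 v deg)
    (A B : GradedAss 𝒱) (hB : B ∈ zariskiClosure (MulAction.orbit (GradedGL 𝒱) A)) :
    ∃ X : GradedFormalDeformation.{u, v, max u v} K (GradedAss.Alg B) (GradedAss.grading B),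
      Nonempty (GradedAlgEquiv F
        (X := F ⊗[K⟦X⟧] X.carrier) (Y := F ⊗[K] GradedAss.Alg A)
        (fun i => (X.grading i).baseChange F)
        (fun i => (GradedAss.grading A i).baseChange F)) := by
  have hinf : Infinite K := IsAlgClosed.instInfinite
  obtain ⟨χ, hχ⟩ := exists_laurent_point (IsScalarTower.toAlgHom K K⟦X⟧ F) hF
    (genericConst deg fun i j k => constPoint v A.1 (i, j, k)) (constPoint v B.1) fun p hp =>
      (mem_zariskiClosure_iff v).1 hB p ((forall_mem_orbit_iff hv A p).2 hp)
  choose c' hc' hcB using hχ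
  let c : ι → ι → ι → K⟦X⟧ := fun i j k => c' (i, j, k)
  obtain ⟨g, hg⟩ : ∃ g, g = (genericUnit deg K).map χ := ⟨_, rfl⟩
  obtain ⟨g', hg'⟩ : ∃ g', g' = (genericUnit deg K)⁻¹.map χ := ⟨_, rfl⟩
  have hgg' : g * g' = 1 := by rw [hg, hg']; exact map_genericUnit_mul_inv χ
  have hg'g : g' * g = 1 := mul_eq_one_comm.1 hgg'
  have hghom : ∀ a b, deg a ≠ deg b → g a b = 0 := fun a b hab => by
    rw [hg, Matrix.map_apply, genericUnit_eq_zero deg a b hab, map_zero]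
  have hg'hom : ∀ a b, deg a ≠ deg b → g' a b = 0 := eq_zero_of_mul_eq_one hgg' hghom
  let x : Basis ι F (F ⊗[K] GradedAss.Alg A) := (algBasis A v).baseChange F
  have hx : HasStructureConstants x
      (fun i j k => algebraMap K F (constPoint v A.1 (i, j, k))) :=
    (hasStructureConstants_algBasis A v).baseChange F
  have hxhom : IsHomogeneousBasis (fun i => (GradedAss.grading A i).baseChange F) x deg :=
    (isHomogeneousBasis_algBasis hv A).baseChange F
  obtain ⟨z, hz⟩ := exists_basis_of_mul_eq_one x hg'g
  have hzhom := hxhom.change hz hg'hom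
  have hcoe : transportConst g g' (fun i j k => algebraMap K F (constPoint v A.1 (i, j, k))) =
      fun i j k => algebraMap K⟦X⟧ F (c i j k) := by
    funext i j k
    rw [hg, hg']
    exact (map_genericConst χ _ (i, j, k)).symm.trans (hc' (i, j, k))
  have hzc := hx.change hg'g hz
  rw [hcoe] at hzc
  have hassoc : IsAssociativeConst c := fun i j k m => hF (by
    simpa only [map_sum, map_mul] using hzc.assoc i j k m)
  have hchom : IsHomogeneousConst deg c := fun i j k h => by
    have h1 := IsHomogeneousConst.transportConst (deg := deg) (c := fun i j k =>
      algebraMap K F (constPoint v A.1 (i, j, k))) (fun i j k h =>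
        isHomogeneousConst_constPoint hv A i j k fun h0 => h (by
          change algebraMap K F (constPoint v A.1 (i, j, k)) = 0
          rw [show constPoint v A.1 (i, j, k) = 0 from h0, map_zero])) hghom hg'hom
    rw [hcoe] at h1
    exact h1 i j k fun h0 => h (hF (h0.trans (map_zero _).symm))
  refine ⟨formalDeformation hv B hassoc hchom fun i j k => hcB (i, j, k), ?_⟩
  exact nonempty_gradedAlgEquiv
    ((StructureAlgebra.isHomogeneousBasis_basis hassoc deg).baseChange F)
    ((StructureAlgebra.hasStructureConstants_basis hassoc).baseChange F) hzhom hzc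

/-- An algebra with a formal deformation whose generic fibre is `A`, over some field `F` containing
`K⟦X⟧`, lies in the closure of the orbit of `A`. -/
theorem mem_closure_of_formalDeformation [Infinite K]
    (hF : Function.Injective (algebraMap K⟦X⟧ F)) (hv : IsHomogeneousBasis 𝒱 v deg)
    (A B : GradedAss 𝒱)
    (X : GradedFormalDeformation.{u, v, w} K (GradedAss.Alg B) (GradedAss.grading B))
    (E : GradedAlgEquiv F
        (X := F ⊗[K⟦X⟧] X.carrier) (Y := F ⊗[K] GradedAss.Alg A)
        (fun i => (X.grading i).baseChange F)
        (fun i => (GradedAss.grading A i).baseChange F)) :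
    B ∈ zariskiClosure (MulAction.orbit (GradedGL 𝒱) A) := by
  obtain ⟨y, c, hyhom, hyc, hcB⟩ := X.exists_basis hv
  let x : Basis ι F (F ⊗[K] GradedAss.Alg A) := (algBasis A v).baseChange F
  have hx : HasStructureConstants x
      (fun i j k => algebraMap K F (constPoint v A.1 (i, j, k))) :=
    (hasStructureConstants_algBasis A v).baseChange F
  have hxhom : IsHomogeneousBasis (fun i => (GradedAss.grading A i).baseChange F) x deg :=
    (isHomogeneousBasis_algBasis hv A).baseChange F
  let z : Basis ι F (F ⊗[K] GradedAss.Alg A) := (y.baseChange F).map E.toLinearEquiv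
  have hz : HasStructureConstants z (fun i j k => algebraMap K⟦X⟧ F (c i j k)) :=
    (hyc.baseChange F).map E
  have hzhom : IsHomogeneousBasis (fun i => (GradedAss.grading A i).baseChange F) z deg :=
    (hyhom.baseChange F).map E
  have hgg' : z.toMatrix x * x.toMatrix z = 1 := Basis.toMatrix_mul_toMatrix_flip z x
  obtain ⟨χ, hg, hg'⟩ := exists_specialization (K := K) (deg := deg) (g := z.toMatrix x)
    (fun a b hab => hzhom.repr_eq_zero (hxhom.mem b) hab) hgg'
  have hcoe := (hx.change (mul_eq_one_comm.1 hgg') fun i => (x.sum_repr (z i)).symm).unique hz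
  rw [mem_zariskiClosure_iff v]
  intro p hp
  have h0 := congrArg χ ((forall_mem_orbit_iff hv A p).1 hp)
  rw [MvPolynomial.comp_aeval_apply, map_zero] at h0
  let q : K⟦X⟧ := MvPolynomial.aeval (fun t : ι × ι × ι => c t.1 t.2.1 t.2.2) p
  have hq : IsScalarTower.toAlgHom K K⟦X⟧ F q = 0 := by
    rw [← h0, MvPolynomial.comp_aeval_apply]
    congr 2
    funext t
    rw [map_genericConst, hg, hg', hcoe]
    rfl
  have hq0 : q = 0 := hF (hq.trans (map_zero _).symm)
  have h1 : (PowerSeries.constantCoeff : K⟦X⟧ →+* K) q =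
      MvPolynomial.eval (constPoint v B.1) p := by
    rw [MvPolynomial.map_aeval, MvPolynomial.coe_eval₂Hom]
    have h2 : (PowerSeries.constantCoeff : K⟦X⟧ →+* K).comp (algebraMap K K⟦X⟧) = RingHom.id K :=
      RingHom.ext fun a => by simp
    rw [h2]
    exact congrArg (fun b => MvPolynomial.eval₂ (RingHom.id K) b p) (funext fun t => hcB _ _ _)
  rw [← h1, hq0, map_zero]

end Correspondence

end GradedDegeneration

open GradedDegeneration in
theorem theorem4p3 {K : Type u} [Field K] [IsAlgClosed K]
    {V : Type v} [AddCommGroup V] [Module K V] [FiniteDimensional K V]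
    (𝒱 : ℤ → Submodule K V) (h𝒱 : DirectSum.IsInternal 𝒱) (A B : GradedAss 𝒱) :
    IsGradedDegeneration B A ↔
      ∃ X : GradedFormalDeformation.{u, v, max u v} K (GradedAss.Alg B) (GradedAss.grading B),
        Nonempty (GradedAlgEquiv K⸨X⸩
          (X := K⸨X⸩ ⊗[K⟦X⟧] X.carrier) (Y := K⸨X⸩ ⊗[K] GradedAss.Alg A)
          (fun i => (X.grading i).baseChange K⸨X⸩)
          (fun i => (GradedAss.grading A i).baseChange K⸨X⸩)) := by
  classical
  have hinf : Infinite K := IsAlgClosed.instInfinite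
  obtain ⟨ι, _, v, deg, hv⟩ := exists_isHomogeneousBasis h𝒱
  have : IsScalarTower K K⟦X⟧ K⸨X⸩ :=
    IsScalarTower.of_algebraMap_eq fun a => (HahnSeries.ofPowerSeries_C a).symm
  have hF : Function.Injective (algebraMap K⟦X⟧ K⸨X⸩) := IsFractionRing.injective K⟦X⟧ K⸨X⸩
  rw [isGradedDegeneration_iff]
  refine ⟨exists_formalDeformation_of_mem_closure K⸨X⸩ hF hv A B, ?_⟩
  rintro ⟨X, ⟨E⟩⟩
  exact mem_closure_of_formalDeformation K⸨X⸩ hF hv A B X E
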